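/- **Setting.** Fix $n\ge 0$. Let $\mathcal C^n(\mathbb R)$ be the set of continuous $f=(f_1,\dots,f_n):\mathbb R\to\mathbb R^n$ for which there is $\lambda(f)\in\mathbb R^n$ with $f(x)/x\to\lambda(f)$ both as $x\to+\infty$ and as $x\to-\infty$. Let $\mathcal C^n_{\le},\mathcal C^n_{\ge},\mathcal C^n_{<},\mathcal C^n_{>}$ be the subsets of those $f$ for which $\lambda(f)$ is nondecreasing, nonincreasing, strictly increasing, strictly decreasing, respectively. Put $Rf(x)=f(-x)$. For $1\le i<n$ define $\mathcal P_{\tau_i}$ as follows. If $\lambda(f)_i\ge\lambda(f)_{i+1}$, then $\mathcal P_{\tau_i}f=f$. If $\lambda(f)_i<\lambda(f)_{i+1}$, then $\mathcal P_{\tau_i}$ replaces $f_i(x)$ by $f_i(x)+S(x)$ and $f_{i+1}(x)$ by $f_{i+1}(x)-S(x)$, where $S(x)=\sup_{z\le x}[f_{i+1}(z)-f_i(z)]$, and leaves the other lines unchanged. Let $\mathcal P_{\bar\tau_i}=R\,\mathcal P_{\tau_i}R$, and let $O(f)$ be the set of images of $f$ under all finite compositions of the maps $\mathcal P_{\tau_i},\mathcal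 P_{\bar\tau_i}$. A path from $(x,a)$ to $(y,b)$, where $x\le y$, is a nonincreasing right-continuous $\pi:[x,y]\to\{b,\dots,a\}$. Its length is $\|\pi\|_f=\sum_{i=b}^a [f_i(t_{i-1})-f_i(t_i)]$, where $t_i=\inf\{t\in[x,y]:\pi(t)\le i\}$ (equal to $y$ if there is no such $t$). For $\mathbf m=(m_1<\dots<m_k)$ in $\{1,\dots,n\}$ and $t<x$, let $f[(t,\mathbf m)\to(x^k,1)]$ be the supremum of $\sum_{j=1}^k\|\pi_j\|_f$ over all $k$-tuples of paths $\pi_j$ from $(t,m_j)$ to $(x,1)$ with $\pi_j<\pi_{j+1}$ on $(t,x)$ for $1\le j<k$, and let $$f[(-\infty,\mathbf m)\to(x^k,1)]=\lim_{t\to-\infty}\Big(f[(t,\mathbf m)\to(x^k,1)]+\sum_{j=1}^k f_{m_j}(t)\Big)$$ when this limit exists. For $\lambda\in\mathbb R^n$, call $\mathbf m$ *$\lambda$-admissible* if $\lambda_{p-1}<\lambda_p$ whenever $p\ge2$ is a coordinate of $\mathbf m$ and $p-1$ is not. **Theorem.** 1. For each $f\in\mathcal C^n_\le$ there is exactly one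 $g=\mathcal P_{\mathrm{RSK}}f\in O(f)\cap\mathcal C^n_\ge$, and for each $g\in\mathcal C^n_\ge$ there is exactly one $\mathcal Q_{\mathrm{RSK}}g\in O(g)\cap\mathcal C^n_\le$. The maps $\mathcal P_{\mathrm{RSK}}:\mathcal C^n_\le\to\mathcal C^n_\ge$ and $\mathcal Q_{\mathrm{RSK}}:\mathcal C^n_\ge\to\mathcal C^n_\le$ are mutually inverse bijections, $\mathcal Q_{\mathrm{RSK}}=R\,\mathcal P_{\mathrm{RSK}}R$, and $\mathcal P_{\mathrm{RSK}}R$ is an involution of $\mathcal C^n_\ge$ (the analogue of the Schützenberger involution). 2. (Analogue of Greene's theorem.) Let $f\in\mathcal C^n_\le$, $g=\mathcal P_{\mathrm{RSK}}f$ and $0\le k\le n$. Among the $\lambda(f)$-admissible vectors of length $k$ there is a coordinatewise greatest one, $\mathbf n_k$; among the $(-\lambda(f)_n,\dots,-\lambda(f)_1)$-admissible vectors of length $k$ there is a coordinatewise greatest one, $\mathbf m_k$. For all $x\in\mathbb R$ the following last passage values exist and satisfy $$f[(-\infty,\mathbf n_k)\to(x^k,1)]=g_1(x)+\dots+g_k(x),\qquad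 Rg[(-\infty,\mathbf m_k)\to((-x)^k,1)]=f_1(x)+\dots+f_k(x).$$ 3. For $f\in\mathcal C^n_<$ the limits in $$\sum_{i=1}^k (Wf)_i(x)=f[(-\infty,(n-k+1,\dots,n))\to(x^k,1)],\qquad 0\le k\le n,\ x\in\mathbb R,$$ exist, so that this formula defines $Wf$, and $Wf=\mathcal P_{\mathrm{RSK}}f$. The map $W$ is a bijection from $\mathcal C^n_<$ onto $\mathcal C^n_>$ with inverse $RWR:\mathcal C^n_>\to\mathcal C^n_<$. -/

import Mathlib

open Filter Topology Set

noncomputable section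

namespace RSKLine

/-- An environment of `n` lines: line `i + 1` of the mathematical notation is `f ⟨i, _⟩`. -/
abbrev Env (n : ℕ) : Type := Fin n → ℝ → ℝ

/-- `f` has asymptotic slope vector `lam`: `f(x) / x → lam`, both as `x → +∞` and as `x → -∞`. -/
def HasSlope {n : ℕ} (f : Env n) (lam : Fin n → ℝ) : Prop :=
  ∀ i, Tendsto (fun x => f i x / x) atTop (𝓝 (lam i)) ∧
    Tendsto (fun x => f i x / x) atBot (𝓝 (lam i))

/-- The space `𝒞ⁿ(ℝ)` of continuous functions `ℝ → ℝⁿ` with an asymptotic slope. -/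
def C (n : ℕ) : Set (Env n) :=
  {f | (∀ i, Continuous (f i)) ∧ ∃ lam, HasSlope f lam}

/-- The slope vector `λ(f)`, meaningful for `f ∈ C n`. -/
def asympSlope {n : ℕ} (f : Env n) : Fin n → ℝ :=
  fun i => limUnder atTop (fun x => f i x / x)

/-- Environments with nondecreasing slopes. -/
def CLE (n : ℕ) : Set (Env n) := {f | f ∈ C n ∧ Monotone (asympSlope f)}

/-- Environments with nonincreasing slopes. -/
def CGE (n : ℕ) : Set (Env n) := {f | f ∈ C n ∧ Antitone (asympSlope f)}

/-- Environments with strictly increasing slopes. -/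
def CLT (n : ℕ) : Set (Env n) := {f | f ∈ C n ∧ StrictMono (asympSlope f)}

/-- Environments with strictly decreasing slopes. -/
def CGT (n : ℕ) : Set (Env n) := {f | f ∈ C n ∧ StrictAnti (asympSlope f)}

/-- The reflection `Rf(x) = f(-x)`. -/
def R {n : ℕ} (f : Env n) : Env n := fun i x => f i (-x)

/-! ### Pitman operators and their orbits -/

open Classical in
/-- The Pitman operator acting on the lines `a` and `b` (used for `b = a + 1`): the identity if
`λ_a ≥ λ_b`; otherwise `sup_{z ≤ x} (f_b(z) - f_a(z))` is added to `f_a(x)` and subtracted from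
`f_b(x)`. -/
def pitman {n : ℕ} (a b : Fin n) : Function.End (Env n) := fun f =>
  if asympSlope f a < asympSlope f b then
    fun i x =>
      if i = a then f a x + ⨆ z : Iic x, (f b z - f a z)
      else if i = b then f b x - ⨆ z : Iic x, (f b z - f a z)
      else f i x
  else f

/-- The co-Pitman operator, `R ∘ pitman ∘ R`. -/
def coPitman {n : ℕ} (a b : Fin n) : Function.End (Env n) := fun f => R (pitman a b (R f))

/-- The monoid of maps generated by the Pitman and co-Pitman operators on adjacent lines. -/
def pitmanMonoid (n : ℕ) : Submonoid (Function.End (Env n)) :=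
  Submonoid.closure
    {P | ∃ a b : Fin n, (a : ℕ) + 1 = b ∧ (P = pitman a b ∨ P = coPitman a b)}

/-- The orbit `O(f)` of `f` under all compositions of (co-)Pitman operators. -/
def orbit {n : ℕ} (f : Env n) : Set (Env n) := {g | ∃ P ∈ pitmanMonoid n, g = P f}

/-- The element of the orbit of `f` with nonincreasing slopes. -/
def PRSK {n : ℕ} (f : Env n) : Env n :=
  Classical.epsilon fun g => g ∈ orbit f ∧ g ∈ CGE n

/-- The element of the orbit of `g` with nondecreasing slopes. -/
def QRSK {n : ℕ} (g : Env n) : Env n :=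
  Classical.epsilon fun f => f ∈ orbit g ∧ f ∈ CLE n

/-! ### Last passage percolation -/

/-- `π`, restricted to `[x, y]`, is a path from `(x, a)` to `(y, b)`: a nonincreasing
right-continuous function `[x, y] → {b, …, a}`. -/
structure IsPath {n : ℕ} (π : ℝ → Fin n) (x : ℝ) (a : Fin n) (y : ℝ) (b : Fin n) : Prop where
  le : x ≤ y
  antitone : AntitoneOn π (Icc x y)
  rightCont : ∀ t ∈ Icc x y, ContinuousWithinAt π (Icc t y) t
  mem : ∀ t ∈ Icc x y, b ≤ π t ∧ π t ≤ a

/-- The time `t_i = inf {t ∈ [x, y] : π(t) ≤ i}` at which `π` reaches line `i` or passes it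
(the infimum is taken in `[x, y]`, so it is `y` if there is no such time). -/
def timeLE {n : ℕ} (π : ℝ → Fin n) (x y : ℝ) (i : Fin n) : ℝ :=
  sInf (insert y {t | t ∈ Icc x y ∧ π t ≤ i})

/-- The time `t_{i-1} = inf {t ∈ [x, y] : π(t) ≤ i - 1}` (in `[x, y]`), at which `π` leaves
line `i`. -/
def timeLT {n : ℕ} (π : ℝ → Fin n) (x y : ℝ) (i : Fin n) : ℝ :=
  sInf (insert y {t | t ∈ Icc x y ∧ π t < i})

/-- The length `∑_{i=b}^a (f_i(t_{i-1}) - f_i(t_i))` of a path from `(x, a)` to `(y, b)`. -/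
def pathLength {n : ℕ} (f : Env n) (π : ℝ → Fin n) (x : ℝ) (a : Fin n) (y : ℝ) (b : Fin n) : ℝ :=
  ∑ i ∈ Finset.Icc b a, (f i (timeLT π x y i) - f i (timeLE π x y i))

/-- Disjoint `k`-tuples of paths from `(x, a)` to `(y, b)`. -/
structure IsDisjointTuple {n k : ℕ} (π : Fin k → ℝ → Fin n)
    (x : Fin k → ℝ) (a : Fin k → Fin n) (y : Fin k → ℝ) (b : Fin k → Fin n) : Prop where
  isPath : ∀ j, IsPath (π j) (x j) (a j) (y j) (b j)
  disjoint : ∀ i j : Fin k, (i : ℕ) + 1 = j →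
    ∀ t ∈ Ioo (x i) (y i) ∩ Ioo (x j) (y j), π i t < π j t

/-- The multi-path last passage value `f[(x, a) → (y, b)]`. -/
def lpp {n k : ℕ} (f : Env n)
    (x : Fin k → ℝ) (a : Fin k → Fin n) (y : Fin k → ℝ) (b : Fin k → Fin n) : ℝ :=
  sSup {L | ∃ π : Fin k → ℝ → Fin n, IsDisjointTuple π x a y b ∧
    L = ∑ j, pathLength f (π j) (x j) (a j) (y j) (b j)}

/-- `f[(t, m) → (x^k, 1)] + ∑_i f_{m_i}(t)`, whose limit as `t → -∞` is the last passage value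
`f[(-∞, m) → (x^k, 1)]`. -/
def lppFrom {n k : ℕ} (f : Env n) (m : Fin k → Fin n) (x t : ℝ) : ℝ :=
  lpp f (fun _ => t) m (fun _ => x) (fun j => ⟨0, (m j).pos⟩) + ∑ j, f (m j) t

/-- `f[(-∞, m) → (x^k, 1)] = v`: the limit defining the left-hand side exists and equals `v`. -/
def HasLppFromBot {n k : ℕ} (f : Env n) (m : Fin k → Fin n) (x v : ℝ) : Prop :=
  Tendsto (lppFrom f m x) atBot (𝓝 v)

/-- The set of `m ∈ {1, …, n}^k_<` such that, whenever `p` is a coordinate of `m` and the line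
`q = p - 1` exists but is not a coordinate of `m`, one has `lam_q < lam_p`. -/
def admissible {n : ℕ} (lam : Fin n → ℝ) (k : ℕ) : Set (Fin k → Fin n) :=
  {m | StrictMono m ∧
    ∀ p q : Fin n, (q : ℕ) + 1 = p → p ∈ range m → q ∉ range m → lam q < lam p}

/-- The vector `(n - k + 1, …, n)` of the last `k` lines. -/
def lastLines (n k : ℕ) (hk : k ≤ n) : Fin k → Fin n :=
  fun j => ⟨n - k + j, by omega⟩

/-- The map `W`, determined by
`∑_{i ≤ k} (Wf)_i(x) = f[(-∞, (n - k + 1, …, n)) → (x^k, 1)]` for `k = 0, …, n`. -/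
def W {n : ℕ} (f : Env n) : Env n := fun i x =>
  limUnder atBot (lppFrom f (lastLines n (i + 1) i.isLt) x) -
    limUnder atBot (lppFrom f (lastLines n i i.isLt.le) x)

end RSKLine

end

namespace RSKLine

/-! A nontrivial Pitman operator on adjacent lines a, b = a + 1 with λ_a < λ_b swaps their slopes,
and the co-Pitman operator undoes it. Orbits are therefore equivalence classes on `C n`, and sorting
by adjacent transpositions puts an element of `CGE n` in every orbit. What needs an invariant is its
uniqueness when the start f lies in `CLE n`.

The invariant is the last passage value from -∞ started on the k lines of largest slope, ties going
to smaller indices (`IsTop`, `TopLpp`). For h = f_b - f_a with running maximum S, the maximum of h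
over [u, v] is S u + S v plus the maximum of h - 2S there. With the other rows of jump times fixed,
the entries of row b range independently over intervals, so optimizing them one by one shows that
finite-time last passage values are unchanged (`IsShift.sSup_weights`) unless the start uses a
without b. If it uses b without a, then after the transform, at a record time t (h t = S t),
starting on b is as good as starting on a. Record times go to -∞ and the corrected values are
monotone in t, so the limits agree.

When slopes are nonincreasing the top lines are the first k, whose paths cannot move, so the
invariant is g_1 + ... + g_k. This gives uniqueness and Greene's theorem at once; when slopes are
nondecreasing the top vector is the greatest admissible one (`IsTop.isGreatest`). The remaining
claims follow by reflection and orbit symmetry. -/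

/-! ### Running maxima -/

/-- `S x` is the maximum of `h` over `(-∞, x]`. -/
structure IsRunMax (h S : ℝ → ℝ) : Prop where
  le : ∀ ⦃z x⦄, z ≤ x → h z ≤ S x
  attained : ∀ x, ∃ z ≤ x, h z = S x

namespace IsRunMax

variable {h S : ℝ → ℝ}

theorem mono (H : IsRunMax h S) : Monotone S := by
  intro x y hxy
  obtain ⟨z, hz, hS⟩ := H.attained x
  rw [← hS]
  exact H.le (hz.trans hxy)

theorem iSup_eq (H : IsRunMax h S) (x : ℝ) : ⨆ z : Iic x, h z = S x := by
  obtain ⟨z, hz, hS⟩ := H.attained x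
  exact IsGreatest.csSup_eq ⟨⟨⟨z, hz⟩, hS⟩, by rintro _ ⟨w, rfl⟩; exact H.le w.2⟩

theorem of_tendsto (hc : Continuous h) (hb : Tendsto h atBot atBot) :
    ∃ S, IsRunMax h S := by
  have key : ∀ x, ∃ z ≤ x, ∀ w ≤ x, h w ≤ h z := by
    intro x
    obtain ⟨T, hT⟩ := eventually_atBot.1 (hb.eventually (eventually_le_atBot (h x)))
    obtain ⟨z, hz, hmax⟩ := (isCompact_Icc (a := min T x) (b := x)).exists_isMaxOn
      ⟨x, min_le_right _ _, le_rfl⟩ hc.continuousOn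
    refine ⟨z, hz.2, fun w hw => ?_⟩
    rcases le_total (min T x) w with hTw | hTw
    · exact hmax ⟨hTw, hw⟩
    · exact (hT w (hTw.trans (min_le_left _ _))).trans (hmax ⟨min_le_right _ _, le_rfl⟩)
  choose z hz hmax using key
  exact ⟨fun x => h (z x), fun w x hw => hmax x w hw, fun x => ⟨z x, hz x, rfl⟩⟩

theorem exists_eq_of_lt (H : IsRunMax h S) {u v : ℝ} (hlt : S u < S v) :
    ∃ z ∈ Icc u v, h z = S v := by
  obtain ⟨z, hz, hS⟩ := H.attained v
  refine ⟨z, ⟨?_, hz⟩, hS⟩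
  by_contra! hzu
  exact absurd (H.le hzu.le) (by rw [hS]; exact not_le.2 hlt)

/-- The witness is the first time in [u, v] at which h reaches the level S u. -/
theorem exists_first_hit (H : IsRunMax h S) (hc : Continuous h) {u v : ℝ} (hlt : S u < S v) :
    ∃ z ∈ Icc u v, h z = S u ∧ S z = S u := by
  obtain ⟨y, hy, hyS⟩ := H.exists_eq_of_lt hlt
  have hK : IsCompact (Icc u v ∩ {w | S u ≤ h w}) :=
    isCompact_Icc.inter_right (isClosed_le continuous_const hc)
  obtain ⟨z, ⟨hzI, hzS⟩, hmin⟩ := hK.exists_isLeast ⟨y, hy, by simp [hyS, hlt.le]⟩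
  have hz : h z = S u := by
    obtain ⟨w, hw, hwS⟩ := intermediate_value_Icc hzI.1 hc.continuousOn ⟨H.le (le_refl u), hzS⟩
    have : z ≤ w := hmin ⟨⟨hw.1, hw.2.trans hzI.2⟩, hwS.ge⟩
    rw [le_antisymm this hw.2, hwS]
  refine ⟨z, hzI, hz, le_antisymm ?_ (H.mono hzI.1)⟩
  obtain ⟨w, hw, hwS⟩ := H.attained z
  rw [← hwS]
  by_contra! hcon
  have huw : u ≤ w := by
    by_contra! hwu
    exact absurd (H.le hwu.le) (not_le.2 hcon)
  have := hmin ⟨⟨huw, hw.trans hzI.2⟩, hcon.le⟩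
  rw [le_antisymm hw this, hz] at hcon
  exact lt_irrefl _ hcon

/-- If S is constant on [u, v], take z' = z. Otherwise h - 2S takes the value -S u at the first hit
of level S u, while h ≤ S v. With `exists_reflected_le` this identifies the maxima of h and of S u +
S v + (h - 2S) over [u, v]. -/
theorem exists_le_reflected (H : IsRunMax h S) (hc : Continuous h) {u v z : ℝ}
    (hu : u ≤ z) (hv : z ≤ v) :
    ∃ z', u ≤ z' ∧ z' ≤ v ∧ h z ≤ S u + S v + (h z' - 2 * S z') := by
  rcases (H.mono (hu.trans hv)).eq_or_lt with heq | hlt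
  · have h1 := H.mono hu
    have h2 := H.mono hv
    exact ⟨z, hu, hv, by linarith⟩
  · obtain ⟨w, hw, h1, h2⟩ := H.exists_first_hit hc hlt
    have := H.le hv
    exact ⟨w, hw.1, hw.2, by linarith⟩

theorem exists_reflected_le (H : IsRunMax h S) {u v z : ℝ} (hu : u ≤ z) (hv : z ≤ v) :
    ∃ z', u ≤ z' ∧ z' ≤ v ∧ S u + S v + (h z - 2 * S z) ≤ h z' := by
  have h1 := H.mono hu
  have h2 := H.mono hv
  rcases (H.mono (hu.trans hv)).eq_or_lt with heq | hlt
  · exact ⟨z, hu, hv, by linarith⟩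
  · obtain ⟨w, hw, h3⟩ := H.exists_eq_of_lt hlt
    have := H.le (le_refl z)
    exact ⟨w, hw.1, hw.2, by linarith⟩

theorem continuous (H : IsRunMax h S) (hc : Continuous h) : Continuous S := by
  rw [Metric.continuous_iff]
  intro x ε hε
  obtain ⟨δ, hδ, hball⟩ := Metric.continuous_iff.1 hc x (ε / 3) (by positivity)
  refine ⟨δ, hδ, fun y hy => ?_⟩
  have near : ∀ w, |w - x| < δ → |h w - h x| < ε / 3 := hball
  rw [Real.dist_eq] at hy ⊢
  have osc : ∀ w w', |w - x| < δ → |w' - x| < δ → h w ≤ h w' + 2 * (ε / 3) := by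
    intro w w' hw hw'
    have h1 := abs_lt.1 (near w hw)
    have h2 := abs_lt.1 (near w' hw')
    linarith
  have step : ∀ p q, p ≤ q → |p - x| < δ → |q - x| < δ → S q ≤ S p + 2 * (ε / 3) := by
    intro p q hpq hp hq
    obtain ⟨z, hz, hS⟩ := H.attained q
    rw [← hS]
    rcases le_total z p with hzp | hzp
    · have := H.le hzp
      linarith
    · have hzx : |z - x| < δ := by
        rw [abs_lt] at *
        constructor <;> linarith
      have := osc z p hzx hp
      have := H.le (le_refl p)
      linarith
  have hx : |x - x| < δ := by simpa using hδ
  rcases le_total x y with hxy | hxy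
  · have h1 := step x y hxy hx hy
    have h2 := H.mono hxy
    rw [abs_lt]
    constructor <;> linarith
  · have h1 := step y x hxy hy hx
    have h2 := H.mono hxy
    rw [abs_lt]
    constructor <;> linarith

theorem tendsto_div_atBot (H : IsRunMax h S) {μ : ℝ} (hμ : 0 < μ)
    (hs : Tendsto (fun x => h x / x) atBot (𝓝 μ)) : Tendsto (fun x => S x / x) atBot (𝓝 μ) := by
  rw [tendsto_order]
  constructor
  · intro a ha
    -- The slope b must also be positive, so that h z < b z ≤ b x for the maximizer z ≤ x.
    obtain ⟨b, hb1, hb2⟩ := exists_between (max_lt ha hμ)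
    obtain ⟨T, hT⟩ := eventually_atBot.1 (hs.eventually (lt_mem_nhds hb2))
    filter_upwards [eventually_le_atBot T, eventually_lt_atBot 0] with x hx hx0
    obtain ⟨z, hz, hS⟩ := H.attained x
    have hz0 : z < 0 := hz.trans_lt hx0
    have h1 := hT z (hz.trans hx)
    rw [lt_div_iff_of_neg hz0, hS] at h1
    have hb0 : 0 < b := (le_max_right _ _).trans_lt hb1
    refine ((le_max_left _ _).trans_lt hb1).trans ?_
    rw [lt_div_iff_of_neg hx0]
    nlinarith
  · intro a ha
    filter_upwards [hs.eventually (gt_mem_nhds ha), eventually_lt_atBot 0] with x hx hx0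
    refine lt_of_le_of_lt ?_ hx
    exact div_le_div_of_nonpos_of_le hx0.le (H.le le_rfl)

theorem tendsto_div_atTop (H : IsRunMax h S) {μ : ℝ} (hμ : 0 < μ)
    (hs : Tendsto (fun x => h x / x) atTop (𝓝 μ)) : Tendsto (fun x => S x / x) atTop (𝓝 μ) := by
  rw [tendsto_order]
  constructor
  · intro a ha
    filter_upwards [hs.eventually (lt_mem_nhds ha), eventually_gt_atTop 0] with x hx hx0
    refine lt_of_lt_of_le hx ?_
    exact div_le_div_of_nonneg_right (H.le le_rfl) hx0.le
  · intro a ha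
    obtain ⟨b, hb1, hb2⟩ := exists_between ha
    obtain ⟨T, hT⟩ := eventually_atTop.1 (hs.eventually (gt_mem_nhds hb1))
    have hb0 : 0 < b := hμ.trans hb1
    -- The second threshold makes a x exceed S (max T 0), which bounds h at every z before the
    -- linear estimate applies.
    filter_upwards [eventually_gt_atTop (max T 0), eventually_gt_atTop (S (max T 0) / a)]
      with x hx hxS
    have hx0 : 0 < x := (le_max_right _ _).trans_lt hx
    rw [div_lt_iff₀ hx0]
    rw [div_lt_iff₀ (hb0.trans hb2)] at hxS
    obtain ⟨z, hz, hS⟩ := H.attained x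
    rw [← hS]
    rcases le_total z (max T 0) with hzT | hzT
    · exact (H.le hzT).trans_lt (by linarith)
    · rcases ((le_max_right _ _).trans hzT).eq_or_lt with h0 | hz0
      · exact (H.le (h0.symm.le.trans (le_max_right T 0))).trans_lt (by linarith)
      · have h1 := hT z ((le_max_left _ _).trans hzT)
        rw [div_lt_iff₀ hz0] at h1
        nlinarith

/-- The Pitman transform of a single function is inverted by the reflected transform. -/
theorem reflected (H : IsRunMax h S) (hc : Continuous h) (ht : Tendsto h atTop atTop) :
    IsRunMax (fun z => h (-z) - 2 * S (-z)) (fun x => -S (-x)) where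
  le := by
    intro z x hzx
    have h1 := H.le (le_refl (-z))
    have h2 := H.mono (neg_le_neg hzx)
    linarith
  attained := by
    intro x
    -- Since h tends to +∞, S grows beyond its value at -x, so h hits the level S (-x) at or after
    -- -x.
    obtain ⟨v, hv⟩ := (ht.eventually (eventually_gt_atTop (S (-x)))).exists
    obtain ⟨z, hz, h1, h2⟩ := H.exists_first_hit hc (hv.trans_le (H.le (le_refl v)))
    refine ⟨-z, by linarith [hz.1], ?_⟩
    simp only [neg_neg, h1, h2]
    ring

end IsRunMax

theorem tendsto_atTop_of_div {h : ℝ → ℝ} {μ : ℝ} (hμ : 0 < μ)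
    (hs : Tendsto (fun x => h x / x) atTop (𝓝 μ)) : Tendsto h atTop atTop := by
  refine (hs.pos_mul_atTop hμ tendsto_id).congr' ?_
  filter_upwards [eventually_gt_atTop 0] with x hx
  simp [hx.ne']

theorem tendsto_atBot_of_div {h : ℝ → ℝ} {μ : ℝ} (hμ : 0 < μ)
    (hs : Tendsto (fun x => h x / x) atBot (𝓝 μ)) : Tendsto h atBot atBot := by
  refine (hs.pos_mul_atBot hμ tendsto_id).congr' ?_
  filter_upwards [eventually_lt_atBot 0] with x hx
  simp [hx.ne]

/-! ### Arrays of jump times -/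

/-- Jump times of `k` disjoint paths from `(t, m)` to `(x, 0)`: `τ j i` is the time from which
path `j` is on a line of index less than `i`. -/
structure IsArray (k : ℕ) (m : ℕ → ℕ) (t x : ℝ) (τ : ℕ → ℕ → ℝ) : Prop where
  zero : ∀ j < k, τ j 0 = x
  anti : ∀ j < k, ∀ i, τ j (i + 1) ≤ τ j i
  ge : ∀ j < k, ∀ i, t ≤ τ j i
  start : ∀ j < k, ∀ i, m j < i → τ j i = t
  inter : ∀ j, j + 1 < k → ∀ i, τ j i ≤ τ (j + 1) (i + 1)

/-- The length of the path with jump times `c`. -/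
def lineWeight (n : ℕ) (F : ℕ → ℝ → ℝ) (c : ℕ → ℝ) : ℝ :=
  ∑ i ∈ Finset.range n, (F i (c i) - F i (c (i + 1)))

/-- The total length of `k` paths with jump times `τ`. -/
def weight (n k : ℕ) (F : ℕ → ℝ → ℝ) (τ : ℕ → ℕ → ℝ) : ℝ :=
  ∑ j ∈ Finset.range k, lineWeight n F (τ j)

section Arrays

variable {n k a : ℕ} {m : ℕ → ℕ} {t x : ℝ} {τ : ℕ → ℕ → ℝ} {F F' : ℕ → ℝ → ℝ} {S : ℝ → ℝ}

theorem IsArray.le (hτ : IsArray k m t x τ) {j : ℕ} (hj : j < k) (i : ℕ) : τ j i ≤ x := by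
  induction i with
  | zero => exact (hτ.zero j hj).le
  | succ i ih => exact (hτ.anti j hj i).trans ih

/-- Replace row `a + 1` of an array. -/
def updateRow (a : ℕ) (τ : ℕ → ℕ → ℝ) (z : ℕ → ℝ) : ℕ → ℕ → ℝ :=
  fun j => Function.update (τ j) (a + 1) (z j)

theorem updateRow_self (z : ℕ → ℝ) (j : ℕ) : updateRow a τ z j (a + 1) = z j := by
  simp [updateRow]

theorem updateRow_of_ne (z : ℕ → ℝ) (j : ℕ) {i : ℕ} (hi : i ≠ a + 1) :
    updateRow a τ z j i = τ j i := by
  simp [updateRow, hi]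

theorem IsArray.updateRow (hτ : IsArray k m t x τ) {m' : ℕ → ℕ} {z : ℕ → ℝ}
    (hlow : ∀ j < k, τ j (a + 2) ≤ z j) (hup : ∀ j < k, z j ≤ τ j a)
    (hprev : ∀ j, j + 1 < k → τ j a ≤ z (j + 1))
    (hnext : ∀ j, j + 1 < k → z j ≤ τ (j + 1) (a + 2))
    (hstart : ∀ j < k, m' j ≤ a → z j = t)
    (hm' : ∀ j < k, ∀ i, i ≠ a + 1 → m' j < i → m j < i) :
    IsArray k m' t x (updateRow a τ z) where
  zero j hj := by rw [updateRow_of_ne _ _ (by omega)]; exact hτ.zero j hj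
  anti j hj i := by
    rcases eq_or_ne i (a + 1) with rfl | h1
    · rw [updateRow_self, updateRow_of_ne _ _ (by omega)]
      exact hlow j hj
    · rw [updateRow_of_ne _ _ h1]
      rcases eq_or_ne i a with rfl | h2
      · rw [updateRow_self]
        exact hup j hj
      · rw [updateRow_of_ne _ _ (by omega)]
        exact hτ.anti j hj i
  ge j hj i := by
    rcases eq_or_ne i (a + 1) with rfl | h1
    · rw [updateRow_self]
      exact (hτ.ge j hj _).trans (hlow j hj)
    · rw [updateRow_of_ne _ _ h1]
      exact hτ.ge j hj i
  start j hj i hi := by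
    rcases eq_or_ne i (a + 1) with rfl | h1
    · rw [updateRow_self]
      exact hstart j hj (by omega)
    · rw [updateRow_of_ne _ _ h1]
      exact hτ.start j hj i (hm' j hj i h1 hi)
  inter j hj i := by
    rcases eq_or_ne i (a + 1) with rfl | h1
    · rw [updateRow_self, updateRow_of_ne _ _ (by omega)]
      exact hnext j hj
    · rw [updateRow_of_ne _ _ h1]
      rcases eq_or_ne i a with rfl | h2
      · rw [updateRow_self]
        exact hprev j hj
      · rw [updateRow_of_ne _ _ (by omega)]
        exact hτ.inter j hj i

/-! ### Effect of the Pitman transform on arrays -/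

/-- The second environment arises from the first by moving `S` from line `a + 1` to line `a`. -/
structure IsShift (a : ℕ) (S : ℝ → ℝ) (F F' : ℕ → ℝ → ℝ) : Prop where
  fst : ∀ z, F' a z = F a z + S z
  snd : ∀ z, F' (a + 1) z = F (a + 1) z - S z
  other : ∀ i, i ≠ a → i ≠ a + 1 → F' i = F i

/-- Only summands a and a + 1 change. The entry in position a + 1 enters through h before the shift
and through h - 2S after it, and the neighbouring entries contribute S. -/
theorem IsShift.lineWeight_update (hF : IsShift a S F F') (ha : a + 1 < n) (c : ℕ → ℝ) (z : ℝ) :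
    lineWeight n F' (Function.update c (a + 1) z) = lineWeight n F c + (S (c a) + S (c (a + 2))) +
      ((F (a + 1) z - F a z - 2 * S z) - (F (a + 1) (c (a + 1)) - F a (c (a + 1)))) := by
  have h : lineWeight n F' (Function.update c (a + 1) z) - lineWeight n F c =
      ∑ i ∈ {a, a + 1}, ((F' i (Function.update c (a + 1) z i) -
        F' i (Function.update c (a + 1) z (i + 1))) - (F i (c i) - F i (c (i + 1)))) := by
    unfold lineWeight
    rw [← Finset.sum_sub_distrib]
    symm
    apply Finset.sum_subset
    · intro i hi
      simp only [Finset.mem_insert, Finset.mem_singleton] at hi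
      simp only [Finset.mem_range]
      omega
    · intro i _ hi
      simp only [Finset.mem_insert, Finset.mem_singleton, not_or] at hi
      rw [hF.other i hi.1 hi.2, Function.update_of_ne hi.2, Function.update_of_ne (by omega),
        sub_self]
  rw [Finset.sum_pair (by omega), Function.update_self, Function.update_of_ne (by omega),
    Function.update_of_ne (by omega), hF.fst, hF.fst, hF.snd, hF.snd] at h
  have h2 : a + 1 + 1 = a + 2 := rfl
  rw [h2] at h
  linarith

theorem IsShift.weight_updateRow (hF : IsShift a S F F') (ha : a + 1 < n) (z : ℕ → ℝ) :
    weight n k F' (updateRow a τ z) = weight n k F τ +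
      ∑ j ∈ Finset.range k, (S (τ j a) + S (τ j (a + 2)) +
        ((F (a + 1) (z j) - F a (z j) - 2 * S (z j)) -
          (F (a + 1) (τ j (a + 1)) - F a (τ j (a + 1))))) := by
  unfold weight updateRow
  rw [← Finset.sum_add_distrib]
  refine Finset.sum_congr rfl fun j _ => ?_
  rw [hF.lineWeight_update ha]
  ring

/-- A maximum and a minimum of the same two numbers are those two numbers again. The index shift
between the two terms makes the defect telescope to the ends. -/
theorem sum_max_add_min (S : ℝ → ℝ) (X Y : ℕ → ℝ) (k : ℕ) :
    ∑ j ∈ Finset.range k, (S (max (X j) (Y j)) + S (min (Y (j + 1)) (X (j + 1)))) =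
      ∑ j ∈ Finset.range k, (S (Y (j + 1)) + S (X j)) +
        ((S (max (X 0) (Y 0)) - S (X 0)) - (S (max (X k) (Y k)) - S (X k))) := by
  have hmm : ∀ p q : ℝ, S (max p q) + S (min q p) = S p + S q := by
    intro p q
    rcases le_total p q with h | h
    · simp [h, add_comm]
    · simp [h]
  induction k with
  | zero => simp
  | succ k ih =>
    rw [Finset.sum_range_succ, ih, Finset.sum_range_succ]
    linarith [hmm (X (k + 1)) (Y (k + 1))]

/-- Given the other rows, the entries of row `a + 1` can be changed independently, each within an
interval; the end points of these intervals are the entries of rows `a` and `a + 2`. -/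
theorem IsArray.exists_updateRow (hτ : IsArray k m t x τ) (htx : t ≤ x)
    (hm : ∀ j < k, m j = a → j + 1 < k ∧ m (j + 1) = a + 1)
    {P : ℝ → ℝ → ℝ → ℝ → Prop}
    (hP : ∀ u v z, u ≤ z → z ≤ v → ∃ z', u ≤ z' ∧ z' ≤ v ∧ P u v z z') :
    ∃ z : ℕ → ℝ, ∃ u v : ℕ → ℝ, IsArray k m t x (RSKLine.updateRow a τ z) ∧
      (∀ j < k, P (u j) (v j) (τ j (a + 1)) (z j)) ∧
      ∀ S : ℝ → ℝ, ∑ j ∈ Finset.range k, (S (u j) + S (v j)) =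
        ∑ j ∈ Finset.range k, (S (τ j a) + S (τ j (a + 2))) := by
  -- Entry j of row a + 1 must lie between max (X j) (Y j) and min (Y (j+1)) (X (j+1)). The
  -- conventions X k = x and Y 0 = t supply the bounds missing for the last and first paths.
  set X : ℕ → ℝ := fun j => if j < k then τ j (a + 2) else x with hX
  set Y : ℕ → ℝ := fun j => if j = 0 then t else τ (j - 1) a with hY
  have hXlt : ∀ {j}, j < k → X j = τ j (a + 2) := fun hj => if_pos hj
  have hXk : X k = x := if_neg (lt_irrefl k)
  have hYs : ∀ j, Y (j + 1) = τ j a := fun j => by simp [hY]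
  have hlow : ∀ j < k, max (X j) (Y j) ≤ τ j (a + 1) := by
    intro j hj
    rw [hXlt hj]
    refine max_le (hτ.anti j hj _) ?_
    cases j with
    | zero => exact hτ.ge _ hj _
    | succ j => rw [hYs]; exact hτ.inter j hj a
  have hup : ∀ j < k, τ j (a + 1) ≤ min (Y (j + 1)) (X (j + 1)) := by
    intro j hj
    rw [hYs]
    refine le_min (hτ.anti j hj a) ?_
    rcases lt_or_ge (j + 1) k with h | h
    · rw [hXlt h]
      exact hτ.inter j h (a + 1)
    · rw [show j + 1 = k by omega, hXk]
      exact hτ.le hj _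
  have key : ∀ j, ∃ z', j < k → max (X j) (Y j) ≤ z' ∧ z' ≤ min (Y (j + 1)) (X (j + 1)) ∧
      P (max (X j) (Y j)) (min (Y (j + 1)) (X (j + 1))) (τ j (a + 1)) z' := by
    intro j
    by_cases hj : j < k
    · obtain ⟨z', h⟩ := hP _ _ _ (hlow j hj) (hup j hj)
      exact ⟨z', fun _ => h⟩
    · exact ⟨0, fun h => absurd h hj⟩
  choose z hz using key
  have hzX : ∀ j < k, τ j (a + 2) ≤ z j := fun j hj => by
    rw [← hXlt hj]
    exact (le_max_left _ _).trans (hz j hj).1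
  have hzY : ∀ j < k, z j ≤ τ j a := fun j hj => by
    rw [← hYs]
    exact (hz j hj).2.1.trans (min_le_left _ _)
  have hzX' : ∀ j, j + 1 < k → z j ≤ τ (j + 1) (a + 2) := fun j hj => by
    rw [← hXlt hj]
    exact (hz j (by omega)).2.1.trans (min_le_right _ _)
  refine ⟨z, fun j => max (X j) (Y j), fun j => min (Y (j + 1)) (X (j + 1)), ?_,
    fun j hj => (hz j hj).2.2, fun S => ?_⟩
  · refine hτ.updateRow hzX hzY (fun j hj => ?_) hzX' (fun j hj hja => ?_) (fun _ _ _ _ h => h)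
    · rw [← hYs]
      exact (le_max_right _ _).trans (hz (j + 1) hj).1
    · refine le_antisymm ?_ ((hτ.ge j hj _).trans (hzX j hj))
      -- A path starting at or below line a needs entry t in row a + 1. Row a forces it when m j <
      -- a; when m j = a it is forced by the next path, which starts on line a + 1.
      rcases hja.lt_or_eq with h | h
      · rw [← hτ.start j hj a h]
        exact hzY j hj
      · obtain ⟨h1, h2⟩ := hm j hj h
        rw [← hτ.start (j + 1) h1 (a + 2) (by omega)]
        exact hzX' j h1
  · rw [sum_max_add_min]
    have hX0 : S (max (X 0) (Y 0)) = S (X 0) := by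
      congr 1
      refine max_eq_left ?_
      have : Y 0 = t := if_pos rfl
      rw [this]
      rcases Nat.eq_zero_or_pos k with hk | hk
      · rw [← hk, hXk]
        exact htx
      · rw [hXlt hk]
        exact hτ.ge 0 hk _
    have hXk' : S (max (X k) (Y k)) = S (X k) := by
      congr 1
      refine max_eq_left ?_
      rw [hXk]
      cases k with
      | zero => exact htx
      | succ k => rw [hYs]; exact hτ.le (Nat.lt_succ_self k) _
    rw [hX0, hXk', sub_self, sub_self, sub_self, add_zero]
    refine Finset.sum_congr rfl fun j hj => ?_
    rw [hYs, hXlt (Finset.mem_range.1 hj)]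

/-- The lengths of the tuples of paths from `(t, m)` to `(x, 0)`. -/
def weights (n k : ℕ) (F : ℕ → ℝ → ℝ) (m : ℕ → ℕ) (t x : ℝ) : Set ℝ :=
  weight n k F '' {τ | IsArray k m t x τ}

/-- Mutually dominating sets have the same upper bounds. The default values of `sSup` on empty and
unbounded sets agree as well, so no side conditions are needed. -/
theorem csSup_eq_of_dominated {A B : Set ℝ} (hAB : ∀ p ∈ A, ∃ q ∈ B, p ≤ q)
    (hBA : ∀ q ∈ B, ∃ p ∈ A, q ≤ p) : sSup A = sSup B := by
  have hub : upperBounds A = upperBounds B := by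
    ext c
    constructor
    · intro hc q hq
      obtain ⟨p, hp, hqp⟩ := hBA q hq
      exact hqp.trans (hc hp)
    · intro hc p hp
      obtain ⟨q, hq, hpq⟩ := hAB p hp
      exact hpq.trans (hc hq)
  rcases A.eq_empty_or_nonempty with rfl | hA
  · rcases B.eq_empty_or_nonempty with rfl | ⟨q, hq⟩
    · rfl
    · obtain ⟨p, hp, _⟩ := hBA q hq
      exact absurd hp (notMem_empty p)
  · obtain ⟨p, hp⟩ := hA
    obtain ⟨q, hq, _⟩ := hAB p hp
    by_cases hb : BddAbove A
    · have hbB : BddAbove B := by rwa [BddAbove, ← hub]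
      have h1 := isLUB_csSup ⟨p, hp⟩ hb
      have h2 := isLUB_csSup ⟨q, hq⟩ hbB
      rw [IsLUB, hub] at h1
      exact h1.unique h2
    · have hbB : ¬ BddAbove B := by rwa [BddAbove, ← hub]
      rw [Real.sSup_of_not_bddAbove hb, Real.sSup_of_not_bddAbove hbB]

/-- The Pitman transform preserves last passage values if the starting vector does not contain
line `a` without line `a + 1`. -/
theorem IsShift.sSup_weights (hF : IsShift a S F F') (ha : a + 1 < n) (htx : t ≤ x)
    (hc : Continuous fun z => F (a + 1) z - F a z)
    (H : IsRunMax (fun z => F (a + 1) z - F a z) S)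
    (hm : ∀ j < k, m j = a → j + 1 < k ∧ m (j + 1) = a + 1) :
    sSup (weights n k F m t x) = sSup (weights n k F' m t x) := by
  apply csSup_eq_of_dominated
  · rintro _ ⟨τ, hτ, rfl⟩
    obtain ⟨z, u, v, hz, hP, hsum⟩ := IsArray.exists_updateRow hτ htx hm
      (fun u v z hu hv => H.exists_le_reflected hc hu hv)
    refine ⟨_, ⟨_, hz, rfl⟩, ?_⟩
    rw [hF.weight_updateRow ha, Finset.sum_add_distrib, ← hsum, ← Finset.sum_add_distrib]
    refine le_add_of_nonneg_right (Finset.sum_nonneg fun j hj => ?_)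
    have := hP j (Finset.mem_range.1 hj)
    linarith
  · rintro _ ⟨τ, hτ, rfl⟩
    obtain ⟨z, u, v, hz, hP, hsum⟩ := IsArray.exists_updateRow hτ htx hm
      (fun u v z hu hv => H.exists_reflected_le hu hv)
    refine ⟨_, ⟨_, hz, rfl⟩, ?_⟩
    -- Restoring the old row a + 1 lets the weight formula be read from the new array back to τ.
    have hback : RSKLine.updateRow a (RSKLine.updateRow a τ z) (fun j => τ j (a + 1)) = τ := by
      funext j
      simp [RSKLine.updateRow]
    have h := hF.weight_updateRow (k := k) (τ := RSKLine.updateRow a τ z) ha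
      (fun j => τ j (a + 1))
    rw [hback] at h
    simp only [updateRow_self, updateRow_of_ne z _ (show a ≠ a + 1 by omega),
      updateRow_of_ne z _ (show a + 2 ≠ a + 1 by omega)] at h
    rw [Finset.sum_add_distrib, ← hsum, ← Finset.sum_add_distrib] at h
    rw [h]
    refine add_le_of_nonpos_right (Finset.sum_nonpos fun j hj => ?_)
    have := hP j (Finset.mem_range.1 hj)
    linarith

/-- At a record time, after the Pitman transform, starting on line `a + 1` is the same as starting
on line `a`. -/
theorem IsShift.sSup_weights_start (hF : IsShift a S F F') (ha : a + 1 < n)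
    (H : IsRunMax (fun z => F (a + 1) z - F a z) S) (hrec : F (a + 1) t - F a t = S t)
    (hmono : ∀ j, j + 1 < k → m j < m (j + 1)) (hma : ∀ j < k, m j ≠ a) {m' : ℕ → ℕ}
    (hm' : ∀ j < k, m' j = if m j = a + 1 then a else m j) :
    sSup (weights n k F' m t x) = sSup (weights n k F' m' t x) := by
  apply csSup_eq_of_dominated
  · rintro _ ⟨τ, hτ, rfl⟩
    -- A zero shift makes the weight formula available for a mere change of row a + 1 inside F'.
    have hshift : IsShift a 0 F' F' := ⟨by simp, by simp, by simp⟩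
    have harr : IsArray k m' t x
        (RSKLine.updateRow a τ fun j => if m j = a + 1 then t else τ j (a + 1)) := by
      refine IsArray.updateRow hτ ?_ ?_ ?_ ?_ ?_ ?_
      · intro j hj
        split_ifs with h
        · exact (hτ.start j hj _ (by omega)).le
        · exact hτ.anti j hj _
      · intro j hj
        split_ifs with h
        · exact hτ.ge j hj _
        · exact hτ.anti j hj _
      · intro j hj
        split_ifs with h
        · have := hmono j hj
          have := hma j (by omega)
          exact (hτ.start j (by omega) a (by omega)).le
        · exact hτ.inter j hj _
      · intro j hj
        split_ifs with h
        · exact hτ.ge _ hj _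
        · exact hτ.inter j hj _
      · intro j hj hja
        have := hm' j hj
        split_ifs at this ⊢ with h
        · rfl
        · exact hτ.start j hj _ (by omega)
      · intro j hj i hi hlt
        have := hm' j hj
        split_ifs at this with h <;> omega
    refine ⟨_, ⟨_, harr, rfl⟩, ?_⟩
    rw [hshift.weight_updateRow ha]
    refine le_add_of_nonneg_right (Finset.sum_nonneg fun j hj => ?_)
    have hj := Finset.mem_range.1 hj
    simp only [Pi.zero_apply, hF.fst, hF.snd]
    split_ifs with h
    · have h1 := H.le (le_refl (τ j (a + 1)))
      have h2 := H.mono (hτ.ge j hj (a + 1))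
      linarith
    · linarith
  · rintro _ ⟨τ, hτ, rfl⟩
    refine ⟨_, ⟨τ, ⟨hτ.zero, hτ.anti, hτ.ge, fun j hj i hi => hτ.start j hj i ?_, hτ.inter⟩, rfl⟩,
      le_rfl⟩
    have := hm' j hj
    split_ifs at this <;> omega

/-! ### Earlier starting times, bounds and rigid starting vectors -/

/-- Moving the starting time from `t` back to `t'`. -/
theorem IsArray.exists_earlier {t' : ℝ} (ht : t' ≤ t) (hτ : IsArray k m t x τ)
    (hmono : ∀ j, j + 1 < k → m j < m (j + 1)) (hmn : ∀ j < k, m j < n) (F : ℕ → ℝ → ℝ) :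
    ∃ τ', IsArray k m t' x τ' ∧ weight n k F τ' =
      weight n k F τ + ∑ j ∈ Finset.range k, (F (m j) t - F (m j) t') := by
  refine ⟨fun j i => if i ≤ m j then τ j i else t', ⟨?_, ?_, ?_, ?_, ?_⟩, ?_⟩
  · intro j hj
    simpa using hτ.zero j hj
  · intro j hj i
    split_ifs with h1 h2 h2
    · exact hτ.anti j hj i
    · omega
    · exact ht.trans (hτ.ge j hj i)
    · exact le_rfl
  · intro j hj i
    split_ifs with h1
    · exact ht.trans (hτ.ge j hj i)
    · exact le_rfl
  · intro j hj i hi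
    exact if_neg (by omega)
  · intro j hj i
    have := hmono j hj
    split_ifs with h1 h2 h2
    · exact hτ.inter j hj i
    · omega
    · exact ht.trans (hτ.ge _ hj _)
    · exact le_rfl
  · unfold weight
    rw [← Finset.sum_add_distrib]
    refine Finset.sum_congr rfl fun j hj => ?_
    have hj := Finset.mem_range.1 hj
    rw [← sub_eq_iff_eq_add']
    unfold lineWeight
    rw [← Finset.sum_sub_distrib, Finset.sum_eq_single_of_mem (m j)
      (Finset.mem_range.2 (hmn j hj))]
    · beta_reduce
      rw [if_pos le_rfl, if_neg (by omega), hτ.start j hj (m j + 1) (by omega)]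
      ring
    · intro i _ hi
      beta_reduce
      rcases hi.lt_or_gt with h | h
      · rw [if_pos h.le, if_pos (by omega), sub_self]
      · rw [if_neg (by omega), if_neg (by omega), hτ.start j hj i h,
          hτ.start j hj (i + 1) (by omega)]
        ring

theorem weights_nonempty (htx : t ≤ x) (hmono : ∀ j, j + 1 < k → m j < m (j + 1)) :
    (weights n k F m t x).Nonempty := by
  refine ⟨_, fun j i => if i ≤ m j then x else t, ⟨?_, ?_, ?_, ?_, ?_⟩, rfl⟩
  · intro j hj
    simp
  · intro j hj i
    split_ifs <;> first | exact le_rfl | exact htx | omega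
  · intro j hj i
    split_ifs
    · exact htx
    · exact le_rfl
  · intro j hj i hi
    exact if_neg (by omega)
  · intro j hj i
    have := hmono j hj
    split_ifs <;> first | exact le_rfl | exact htx | omega

theorem weights_bddAbove (hF : ∀ i, Continuous (F i)) : BddAbove (weights n k F m t x) := by
  have key : ∀ i, ∃ B, ∀ y ∈ Icc t x, |F i y| ≤ B := fun i => by
    obtain ⟨B, hB⟩ := isCompact_Icc.exists_bound_of_continuousOn (hF i).continuousOn
    exact ⟨B, hB⟩
  choose B hB using key
  refine ⟨∑ j ∈ Finset.range k, ∑ i ∈ Finset.range n, 2 * B i, ?_⟩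
  rintro _ ⟨τ, hτ, rfl⟩
  refine Finset.sum_le_sum fun j hj => Finset.sum_le_sum fun i _ => ?_
  have hj := Finset.mem_range.1 hj
  have h1 := abs_le.1 (hB i (τ j i) ⟨hτ.ge j hj i, hτ.le hj i⟩)
  have h2 := abs_le.1 (hB i (τ j (i + 1)) ⟨hτ.ge j hj _, hτ.le hj _⟩)
  linarith

/-- Paths starting from the first `k` lines cannot leave their lines. -/
theorem weights_firstLines (hkn : k ≤ n) (htx : t ≤ x) :
    weights n k F (fun j => j) t x = {∑ j ∈ Finset.range k, (F j x - F j t)} := by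
  refine eq_singleton_iff_nonempty_unique_mem.2
    ⟨weights_nonempty htx fun j _ => Nat.lt_succ_self j, ?_⟩
  rintro _ ⟨τ, hτ, rfl⟩
  -- By interlacing, path j cannot go below line j before x, since j disjoint paths lie under it.
  have hx : ∀ i j, j < k → i ≤ j → τ j i = x := by
    intro i
    induction i with
    | zero => exact fun j hj _ => hτ.zero j hj
    | succ i ih =>
      intro j hj hij
      obtain ⟨j, rfl⟩ : ∃ j', j = j' + 1 := ⟨j - 1, by omega⟩
      refine le_antisymm (hτ.le hj _) ?_
      rw [← ih j (by omega) (by omega)]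
      exact hτ.inter j hj i
  refine Finset.sum_congr rfl fun j hj => ?_
  have hj := Finset.mem_range.1 hj
  unfold lineWeight
  rw [Finset.sum_eq_single_of_mem j (Finset.mem_range.2 (by omega))]
  · rw [hx j j hj le_rfl, hτ.start j hj (j + 1) (Nat.lt_succ_self j)]
  · intro i _ hi
    rcases hi.lt_or_gt with h | h
    · rw [hx i j hj h.le, hx (i + 1) j hj h, sub_self]
    · rw [hτ.start j hj i h, hτ.start j hj (i + 1) (by omega), sub_self]

end Arrays

/-! ### Slopes, reflection and Pitman operators -/

section Pitman

variable {n : ℕ} {f g : Env n} {lam : Fin n → ℝ} {a b : Fin n}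

theorem HasSlope.asympSlope_eq (h : HasSlope f lam) : asympSlope f = lam :=
  funext fun i => (h i).1.limUnder_eq

theorem hasSlope_of_mem (hf : f ∈ C n) : HasSlope f (asympSlope f) := by
  obtain ⟨_, lam, h⟩ := hf
  rwa [h.asympSlope_eq]

theorem R_R (f : Env n) : R (R f) = f := by
  funext i x
  simp [R]

theorem HasSlope.reflect (h : HasSlope f lam) : HasSlope (R f) (fun i => -lam i) := by
  have key : ∀ i x, R f i x / x = -(f i (-x) / (-x)) := fun i x => by
    rw [div_neg, neg_neg, R]
  intro i
  simp only [key]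
  exact ⟨((h i).2.comp tendsto_neg_atTop_atBot).neg, ((h i).1.comp tendsto_neg_atBot_atTop).neg⟩

theorem R_mem_C (hf : f ∈ C n) : R f ∈ C n :=
  ⟨fun i => (hf.1 i).comp continuous_neg, _, (hasSlope_of_mem hf).reflect⟩

theorem asympSlope_R (hf : f ∈ C n) : asympSlope (R f) = fun i => -asympSlope f i :=
  (hasSlope_of_mem hf).reflect.asympSlope_eq

theorem R_mem_CGE (hf : f ∈ CLE n) : R f ∈ CGE n :=
  ⟨R_mem_C hf.1, by rw [asympSlope_R hf.1]; exact hf.2.neg⟩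

theorem R_mem_CLE (hf : f ∈ CGE n) : R f ∈ CLE n :=
  ⟨R_mem_C hf.1, by rw [asympSlope_R hf.1]; exact hf.2.neg⟩

theorem R_mem_CLT (hf : f ∈ CGT n) : R f ∈ CLT n :=
  ⟨R_mem_C hf.1, by rw [asympSlope_R hf.1]; exact hf.2.neg⟩

theorem pitman_of_le (h : asympSlope f b ≤ asympSlope f a) : pitman a b f = f :=
  if_neg (not_lt.2 h)

theorem exists_isRunMax (hf : f ∈ C n) (hab : asympSlope f a < asympSlope f b) :
    ∃ S, IsRunMax (fun z => f b z - f a z) S := by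
  refine IsRunMax.of_tendsto ((hf.1 b).sub (hf.1 a))
    (tendsto_atBot_of_div (sub_pos.2 hab) ?_)
  simp only [sub_div]
  exact (hasSlope_of_mem hf b).2.sub (hasSlope_of_mem hf a).2

theorem pitman_apply (hab : asympSlope f a < asympSlope f b) {S : ℝ → ℝ}
    (H : IsRunMax (fun z => f b z - f a z) S) (i : Fin n) (x : ℝ) :
    pitman a b f i x = if i = a then f a x + S x else if i = b then f b x - S x else f i x := by
  rw [pitman, if_pos hab]
  simp only [H.iSup_eq x]

/-- The running maximum has slope λ_b - λ_a at both ends because this number is positive; adding it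
to line a and subtracting it from line b swaps the slopes. -/
theorem pitman_mem (hf : f ∈ C n) (hab : asympSlope f a < asympSlope f b) :
    pitman a b f ∈ C n ∧ asympSlope (pitman a b f) = asympSlope f ∘ Equiv.swap a b := by
  obtain ⟨S, H⟩ := exists_isRunMax hf hab
  have hc : Continuous S := H.continuous ((hf.1 b).sub (hf.1 a))
  have hs := hasSlope_of_mem hf
  have hne : a ≠ b := fun h => lt_irrefl _ (h ▸ hab)
  have hT : Tendsto (fun x => S x / x) atTop (𝓝 (asympSlope f b - asympSlope f a)) := by
    refine H.tendsto_div_atTop (sub_pos.2 hab) ?_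
    simp only [sub_div]
    exact (hs b).1.sub (hs a).1
  have hB : Tendsto (fun x => S x / x) atBot (𝓝 (asympSlope f b - asympSlope f a)) := by
    refine H.tendsto_div_atBot (sub_pos.2 hab) ?_
    simp only [sub_div]
    exact (hs b).2.sub (hs a).2
  have hslope : HasSlope (pitman a b f) (asympSlope f ∘ Equiv.swap a b) := by
    intro i
    simp only [pitman_apply hab H, Function.comp_apply]
    rcases eq_or_ne i a with rfl | hia
    · simp only [if_true, Equiv.swap_apply_left, add_div]
      constructor
      · simpa using (hs i).1.add hT
      · simpa using (hs i).2.add hB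
    · rcases eq_or_ne i b with rfl | hib
      · simp only [if_neg hia, if_true, Equiv.swap_apply_right, sub_div]
        constructor
        · simpa using (hs i).1.sub hT
        · simpa using (hs i).2.sub hB
      · simp only [if_neg hia, if_neg hib, Equiv.swap_apply_of_ne_of_ne hia hib]
        exact hs i
  refine ⟨⟨fun i => ?_, _, hslope⟩, hslope.asympSlope_eq⟩
  have : pitman a b f i =
      fun x => if i = a then f a x + S x else if i = b then f b x - S x else f i x :=
    funext fun x => pitman_apply hab H i x
  rw [this]
  split_ifs
  · exact (hf.1 a).add hc
  · exact (hf.1 b).sub hc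
  · exact hf.1 i

/-- The new difference of lines is h - 2S, and by `IsRunMax.reflected` its reflection has running
maximum -S(-x), so exactly S is moved back. -/
theorem coPitman_pitman (hf : f ∈ C n) (hab : asympSlope f a < asympSlope f b) :
    coPitman a b (pitman a b f) = f := by
  obtain ⟨S, H⟩ := exists_isRunMax hf hab
  have hs := hasSlope_of_mem hf
  have hne : b ≠ a := fun h => lt_irrefl _ (h ▸ hab)
  obtain ⟨hg, hslope⟩ := pitman_mem hf hab
  have hT : Tendsto (fun z => f b z - f a z) atTop atTop := by
    refine tendsto_atTop_of_div (sub_pos.2 hab) ?_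
    simp only [sub_div]
    exact (hs b).1.sub (hs a).1
  have hab' : asympSlope (R (pitman a b f)) a < asympSlope (R (pitman a b f)) b := by
    simpa [asympSlope_R hg, hslope] using hab
  have H' : IsRunMax (fun z => R (pitman a b f) b z - R (pitman a b f) a z)
      (fun x => -S (-x)) := by
    convert H.reflected ((hf.1 b).sub (hf.1 a)) hT using 2 with z
    simp only [R, pitman_apply hab H, if_neg hne, if_true]
    ring
  funext i x
  rw [coPitman, R, pitman_apply hab' H']
  simp only [R, neg_neg, pitman_apply hab H, if_neg hne, if_true]
  split_ifs with h1 h2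
  · rw [h1]; ring
  · rw [h2]; ring
  · rfl

theorem coPitman_R (f : Env n) : coPitman a b (R f) = R (pitman a b f) := by
  rw [coPitman, R_R]

theorem pitman_R (f : Env n) : pitman a b (R f) = R (coPitman a b f) := by
  rw [coPitman, R_R]

/-! ### Orbits -/

theorem self_mem_orbit (f : Env n) : f ∈ orbit f := ⟨1, one_mem _, rfl⟩

theorem orbit_trans {e : Env n} (hfg : g ∈ orbit f) (hge : e ∈ orbit g) : e ∈ orbit f := by
  obtain ⟨P, hP, rfl⟩ := hfg
  obtain ⟨Q, hQ, rfl⟩ := hge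
  exact ⟨Q * P, mul_mem hQ hP, rfl⟩

theorem pitman_mem_orbit (hab : (a : ℕ) + 1 = b) (f : Env n) : pitman a b f ∈ orbit f :=
  ⟨_, Submonoid.subset_closure ⟨a, b, hab, Or.inl rfl⟩, rfl⟩

theorem coPitman_mem_orbit (hab : (a : ℕ) + 1 = b) (f : Env n) : coPitman a b f ∈ orbit f :=
  ⟨_, Submonoid.subset_closure ⟨a, b, hab, Or.inr rfl⟩, rfl⟩

theorem orbit_induction {p : Env n → Prop} (hf : p f)
    (hpit : ∀ g (a b : Fin n), (a : ℕ) + 1 = b → p g → p (pitman a b g))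
    (hco : ∀ g (a b : Fin n), (a : ℕ) + 1 = b → p g → p (coPitman a b g)) (hg : g ∈ orbit f) : p g := by
  obtain ⟨P, hP, rfl⟩ := hg
  induction hP using Submonoid.closure_induction_left with
  | one => exact hf
  | mul_left Q hQ P _ ih =>
    obtain ⟨a, b, hab, rfl | rfl⟩ := hQ
    · exact hpit _ a b hab ih
    · exact hco _ a b hab ih

theorem R_mem_orbit (hg : g ∈ orbit f) : R g ∈ orbit (R f) := by
  refine orbit_induction (p := fun g => R g ∈ orbit (R f)) (self_mem_orbit _) ?_ ?_ hg
  · intro g a b hab h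
    rw [← coPitman_R]
    exact orbit_trans h (coPitman_mem_orbit hab _)
  · intro g a b hab h
    rw [← pitman_R]
    exact orbit_trans h (pitman_mem_orbit hab _)

/-- A property of environments with slopes that is preserved by all nontrivial applications of
Pitman operators, in both directions, is constant on orbits. -/
theorem orbit_induction_of_iff {p : Env n → Prop} (hfC : f ∈ C n)
    (hp : ∀ g ∈ C n, ∀ a b : Fin n, (a : ℕ) + 1 = b → asympSlope g a < asympSlope g b →
      (p g ↔ p (pitman a b g))) (hg : g ∈ orbit f) : g ∈ C n ∧ (p f ↔ p g) := by
  refine orbit_induction (p := fun g => g ∈ C n ∧ (p f ↔ p g)) ⟨hfC, Iff.rfl⟩ ?_ ?_ hg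
  · rintro g a b hab ⟨hg, h⟩
    by_cases hlt : asympSlope g a < asympSlope g b
    · exact ⟨(pitman_mem hg hlt).1, h.trans (hp g hg a b hab hlt)⟩
    · rw [pitman_of_le (not_lt.1 hlt)]
      exact ⟨hg, h⟩
  · rintro g a b hab ⟨hg, h⟩
    have hRg := R_mem_C hg
    by_cases hlt : asympSlope (R g) a < asympSlope (R g) b
    · obtain ⟨h1, h2⟩ := pitman_mem hRg hlt
      have hinv : pitman a b (coPitman a b g) = g := by
        rw [coPitman, pitman_R, coPitman_pitman hRg hlt, R_R]
      have hC : coPitman a b g ∈ C n := R_mem_C h1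
      have hlt' : asympSlope (coPitman a b g) a < asympSlope (coPitman a b g) b := by
        rw [coPitman, asympSlope_R h1, h2]
        simpa using hlt
      refine ⟨hC, h.trans ?_⟩
      rw [hp _ hC a b hab hlt', hinv]
    · rw [coPitman, pitman_of_le (not_lt.1 hlt), R_R]
      exact ⟨hg, h⟩

theorem orbit_symm (hf : f ∈ C n) (hg : g ∈ orbit f) : f ∈ orbit g := by
  refine ((orbit_induction_of_iff (p := fun g => f ∈ orbit g) hf ?_ hg).2).1 (self_mem_orbit f)
  intro g hg a b hab hlt
  refine ⟨fun h => orbit_trans ?_ h, fun h => orbit_trans (pitman_mem_orbit hab g) h⟩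
  have := coPitman_mem_orbit hab (pitman a b g)
  rwa [coPitman_pitman hg hlt] at this

theorem exists_perm_of_mem_orbit (hf : f ∈ C n) (hg : g ∈ orbit f) :
    ∃ σ : Equiv.Perm (Fin n), asympSlope g = asympSlope f ∘ σ := by
  refine ((orbit_induction_of_iff
    (p := fun g => ∃ σ : Equiv.Perm (Fin n), asympSlope g = asympSlope f ∘ σ) hf ?_ hg).2).1
    ⟨1, rfl⟩
  intro g hg a b hab hlt
  rw [(pitman_mem hg hlt).2]
  constructor
  · rintro ⟨σ, h⟩
    exact ⟨σ * Equiv.swap a b, by rw [h]; rfl⟩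
  · rintro ⟨σ, h⟩
    refine ⟨σ * Equiv.swap a b, ?_⟩
    funext i
    have := congrFun h (Equiv.swap a b i)
    simpa using this

theorem antitone_of_adjacent (h : ∀ a b : Fin n, (a : ℕ) + 1 = b → lam b ≤ lam a) :
    Antitone lam := by
  cases n with
  | zero => exact fun i => i.elim0
  | succ n => exact Fin.antitone_iff_succ_le.2 fun i => h _ _ rfl

/-- Sorting the slopes by adjacent transpositions. -/
theorem exists_mem_orbit_CGE (hf : f ∈ C n) : ∃ g ∈ orbit f, g ∈ CGE n := by
  classical
  -- Potential for the sorting: each line index times the number of strictly smaller slopes. Moving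
  -- a larger slope from b to a = b - 1 decreases it.
  obtain ⟨N, hN⟩ : ∃ N, ∑ i : Fin n, (i : ℕ) *
      (Finset.univ.filter fun q => asympSlope f q < asympSlope f i).card = N := ⟨_, rfl⟩
  induction N using Nat.strong_induction_on generalizing f with
  | _ N ih =>
    by_cases hadj : ∀ a b : Fin n, (a : ℕ) + 1 = b → asympSlope f b ≤ asympSlope f a
    · exact ⟨f, self_mem_orbit f, hf, antitone_of_adjacent hadj⟩
    push Not at hadj
    obtain ⟨a, b, hab, hlt⟩ := hadj
    obtain ⟨hC, hslope⟩ := pitman_mem hf hlt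
    set ρ : Fin n → ℕ := fun i =>
      (Finset.univ.filter fun q => asympSlope f q < asympSlope f i).card with hρ
    have hρlt : ρ a < ρ b := by
      apply Finset.card_lt_card
      rw [Finset.ssubset_iff_of_subset]
      · exact ⟨a, by simpa using hlt, by simp⟩
      · intro q hq
        simp only [Finset.mem_filter, Finset.mem_univ, true_and] at hq ⊢
        exact hq.trans hlt
    have hρ' : ∀ i, (Finset.univ.filter fun q => asympSlope (pitman a b f) q <
        asympSlope (pitman a b f) i).card = ρ (Equiv.swap a b i) := by
      intro i
      refine Finset.card_equiv (Equiv.swap a b) fun q => ?_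
      simp [hslope]
    have hsum : ∑ i : Fin n, (i : ℕ) * ρ (Equiv.swap a b i) < ∑ i : Fin n, (i : ℕ) * ρ i := by
      have hne : a ≠ b := fun h => lt_irrefl _ (h ▸ hlt)
      have hsplit : ∀ w : Fin n → ℕ, ∑ i, w i = w a + w b + ∑ i ∈ {a, b}ᶜ, w i := fun w => by
        rw [← Finset.sum_pair hne, Finset.sum_add_sum_compl]
      rw [hsplit, hsplit fun i => (i : ℕ) * ρ i]
      refine add_lt_add_of_lt_of_le ?_ (Finset.sum_le_sum fun i hi => ?_)
      · rw [Equiv.swap_apply_left, Equiv.swap_apply_right, ← hab]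
        nlinarith
      · simp only [Finset.mem_compl, Finset.mem_insert, Finset.mem_singleton, not_or] at hi
        rw [Equiv.swap_apply_of_ne_of_ne hi.1 hi.2]
    obtain ⟨g, hg, hg'⟩ := ih _ (hN ▸ hsum) hC (by simp only [hρ'])
    exact ⟨g, orbit_trans (pitman_mem_orbit hab f) hg, hg'⟩

end Pitman

/-! ### Paths and jump times -/

/-- The first time at which `π` is on a line of index less than `i`. -/
noncomputable def jumpTime {n : ℕ} (π : ℝ → Fin n) (t x : ℝ) (i : ℕ) : ℝ :=
  sInf (insert x {s | s ∈ Icc t x ∧ (π s : ℕ) < i})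

/-- Extension of an environment by zero to all natural indices. -/
def envNat {n : ℕ} (f : Env n) : ℕ → ℝ → ℝ := fun i => if h : i < n then f ⟨i, h⟩ else 0

/-- Extension of a vector by zero to all natural indices. -/
def vecNat {n k : ℕ} (m : Fin k → Fin n) : ℕ → ℕ := fun j => if h : j < k then m ⟨j, h⟩ else 0

section Paths

variable {n k : ℕ} {f : Env n} {π : ℝ → Fin n} {m : Fin k → Fin n} {a : Fin n} {t x : ℝ}
  {c : ℕ → ℝ}

theorem envNat_val (f : Env n) (i : Fin n) : envNat f i = f i := dif_pos i.2

theorem vecNat_val (m : Fin k → Fin n) (j : Fin k) : vecNat m j = m j := dif_pos j.2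

theorem continuous_envNat (hf : ∀ i, Continuous (f i)) (i : ℕ) : Continuous (envNat f i) := by
  unfold envNat
  split_ifs
  · exact hf _
  · exact continuous_const

theorem jumpTime_le_of_mem {s : ℝ} {i : ℕ} (hs : s ∈ Icc t x) (hi : (π s : ℕ) < i) :
    jumpTime π t x i ≤ s :=
  csInf_le ⟨t, by
    rintro r (rfl | hr)
    · exact hs.1.trans hs.2
    · exact hr.1.1⟩ (Or.inr ⟨hs, hi⟩)

theorem jumpTime_le (htx : t ≤ x) (i : ℕ) : jumpTime π t x i ≤ x :=
  csInf_le ⟨t, by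
    rintro r (rfl | hr)
    · exact htx
    · exact hr.1.1⟩ (Or.inl rfl)

theorem le_jumpTime {i : ℕ} {r : ℝ} (hx : r ≤ x)
    (h : ∀ s ∈ Icc t x, (π s : ℕ) < i → r ≤ s) : r ≤ jumpTime π t x i := by
  refine le_csInf ⟨x, Or.inl rfl⟩ ?_
  rintro s (rfl | hs)
  · exact hx
  · exact h s hs.1 hs.2

theorem jumpTime_zero : jumpTime π t x 0 = x := by
  simp [jumpTime]

theorem jumpTime_eq_start (htx : t ≤ x) (hπ : π t ≤ a) {i : ℕ} (hi : (a : ℕ) < i) :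
    jumpTime π t x i = t :=
  le_antisymm (jumpTime_le_of_mem ⟨le_rfl, htx⟩ (lt_of_le_of_lt hπ hi))
    (le_jumpTime htx fun _ hs _ => hs.1)

theorem pathLength_eq (htx : t ≤ x) (hπ : π t ≤ a) (h0 : 0 < n) :
    pathLength f π t a x ⟨0, h0⟩ = lineWeight n (envNat f) (jumpTime π t x) := by
  have hLE : ∀ i : Fin n, timeLE π t x i = jumpTime π t x (i + 1) := fun i => by
    simp only [timeLE, jumpTime, Nat.lt_succ_iff, Fin.le_def]
  unfold pathLength lineWeight
  rw [Finset.sum_range]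
  simp only [envNat_val, hLE]
  refine Finset.sum_subset (Finset.subset_univ _) fun i _ hi => ?_
  have hia : a < i := by
    by_contra! h
    exact hi (Finset.mem_Icc.2 ⟨Fin.le_def.2 (Nat.zero_le _), h⟩)
  change f i (jumpTime π t x i) - _ = 0
  rw [jumpTime_eq_start htx hπ hia, jumpTime_eq_start htx hπ (Nat.lt_succ_of_lt hia), sub_self]

/-- The path on lines `a, …, 0` with jump times `c`. -/
noncomputable def pathOf (c : ℕ → ℝ) (a : Fin n) (s : ℝ) : Fin n :=
  ⟨((Finset.range a).filter fun i => s < c (i + 1)).card,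
    ((Finset.card_filter_le _ _).trans (Finset.card_range _).le).trans_lt a.2⟩

theorem pathOf_le (c : ℕ → ℝ) (a : Fin n) (s : ℝ) : pathOf c a s ≤ a :=
  (Finset.card_filter_le _ _).trans (Finset.card_range _).le

theorem pathOf_lt_iff (hc : Antitone c) {s : ℝ} (hs : c (a + 1) ≤ s) {i : ℕ} (hi : 1 ≤ i) :
    (pathOf c a s : ℕ) < i ↔ c i ≤ s := by
  constructor
  · intro h
    by_contra! hlt
    have hia : i ≤ a := by
      by_contra! h'
      exact absurd ((hc h').trans hs) (not_le.2 hlt)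
    have : Finset.range i ⊆ (Finset.range a).filter fun i => s < c (i + 1) := by
      intro i' hi'
      rw [Finset.mem_range] at hi'
      rw [Finset.mem_filter, Finset.mem_range]
      exact ⟨by omega, hlt.trans_le (hc hi')⟩
    have := Finset.card_le_card this
    rw [Finset.card_range] at this
    exact absurd h (not_lt.2 this)
  · intro h
    have : (Finset.range a).filter (fun i => s < c (i + 1)) ⊆ Finset.range (i - 1) := by
      intro i' hi'
      rw [Finset.mem_filter] at hi'
      rw [Finset.mem_range]
      by_contra! h'
      exact absurd ((hc (show i ≤ i' + 1 by omega)).trans h) (not_le.2 hi'.2)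
    have := Finset.card_le_card this
    rw [Finset.card_range] at this
    exact lt_of_le_of_lt this (by omega)

theorem isPath_pathOf (htx : t ≤ x) (h0 : 0 < n) : IsPath (pathOf c a) t a x ⟨0, h0⟩ where
  le := htx
  antitone := by
    intro s _ s' _ hss
    rw [Fin.le_def]
    simp only [pathOf]
    refine Finset.card_le_card fun i hi => ?_
    rw [Finset.mem_filter] at hi ⊢
    exact ⟨hi.1, hss.trans_lt hi.2⟩
  rightCont := by
    intro s hs
    refine (continuousWithinAt_const (b := pathOf c a s)).congr_of_eventuallyEq ?_ rfl
    have key : ∀ i ∈ Finset.range a, ∀ᶠ s' in 𝓝[Icc s x] s, (s' < c (i + 1) ↔ s < c (i + 1)) := by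
      intro i _
      rcases lt_or_ge s (c (i + 1)) with h | h
      · filter_upwards [mem_nhdsWithin_of_mem_nhds (gt_mem_nhds h)] with s' hs'
        exact iff_of_true hs' h
      · filter_upwards [self_mem_nhdsWithin] with s' hs'
        exact iff_of_false (not_lt.2 (h.trans hs'.1)) (not_lt.2 h)
    filter_upwards [(Finset.eventually_all _).2 key] with s' hs'
    exact Fin.ext (congrArg Finset.card (Finset.filter_congr hs'))
  mem := fun s _ => ⟨Fin.le_def.2 (Nat.zero_le _), pathOf_le c a s⟩

theorem jumpTime_pathOf (hc : Antitone c) (h0 : c 0 = x) (ht : ∀ i, t ≤ c i)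
    (ha : c (a + 1) = t) : jumpTime (pathOf c a) t x = c := by
  funext i
  have hx : ∀ i, c i ≤ x := fun i => h0 ▸ hc (Nat.zero_le i)
  rcases Nat.eq_zero_or_pos i with rfl | hi
  · rw [jumpTime_zero, h0]
  · refine le_antisymm (jumpTime_le_of_mem ⟨ht i, hx i⟩ ?_) (le_jumpTime (hx i) fun s hs h => ?_)
    · rw [pathOf_lt_iff hc (ha ▸ ht i) hi]
    · rwa [pathOf_lt_iff hc (ha ▸ hs.1) hi] at h

theorem lpp_eq (htx : t < x) :
    lpp f (fun _ => t) m (fun _ => x) (fun j => ⟨0, (m j).pos⟩) =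
      sSup (weights n k (envNat f) (vecNat m) t x) := by
  unfold lpp
  congr 1
  ext L
  constructor
  · rintro ⟨π, hπ, rfl⟩
    have hstart : ∀ j, π j t ≤ m j := fun j => ((hπ.isPath j).mem t ⟨le_rfl, htx.le⟩).2
    refine ⟨fun j i => if h : j < k then jumpTime (π ⟨j, h⟩) t x i else 0,
      ⟨?_, ?_, ?_, ?_, ?_⟩, ?_⟩
    · intro j hj
      rw [dif_pos hj, jumpTime_zero]
    · intro j hj i
      simp only [dif_pos hj]
      exact le_jumpTime (jumpTime_le htx.le _) fun s hs h =>
        jumpTime_le_of_mem hs (Nat.lt_succ_of_lt h)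
    · intro j hj i
      simp only [dif_pos hj]
      exact le_jumpTime htx.le fun s hs _ => hs.1
    · intro j hj i hi
      simp only [dif_pos hj]
      rw [vecNat, dif_pos hj] at hi
      exact jumpTime_eq_start htx.le (hstart _) hi
    · intro j hj i
      have hj' : j < k := by omega
      simp only [dif_pos hj, dif_pos hj']
      refine le_jumpTime (jumpTime_le htx.le _) fun s hs h => ?_
      -- Disjointness is known only in the open interval, so s is approached from the right by
      -- interior times; this covers s = t, and s = x is trivial.
      have key : ∀ s' ∈ Ioo t x, s ≤ s' → jumpTime (π ⟨j, hj'⟩) t x i ≤ s' := by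
        intro s' hs' hss
        have hI : s' ∈ Icc t x := ⟨hs'.1.le, hs'.2.le⟩
        refine jumpTime_le_of_mem hI ?_
        have h1 : (π ⟨j + 1, hj⟩ s' : ℕ) ≤ π ⟨j + 1, hj⟩ s :=
          (hπ.isPath ⟨j + 1, hj⟩).antitone hs hI hss
        have h2 : (π ⟨j, hj'⟩ s' : ℕ) < π ⟨j + 1, hj⟩ s' :=
          hπ.disjoint ⟨j, hj'⟩ ⟨j + 1, hj⟩ rfl s' ⟨hs', hs'⟩
        omega
      rcases hs.2.eq_or_lt with rfl | hsx
      · exact jumpTime_le htx.le _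
      · exact le_of_forall_gt_imp_ge_of_dense fun r hr =>
          (key (min r ((s + x) / 2)) ⟨lt_min (hs.1.trans_lt hr) (by linarith [hs.1]),
            (min_le_right _ _).trans_lt (by linarith)⟩ (le_min hr.le (by linarith))).trans
            (min_le_left _ _)
    · unfold weight
      rw [Finset.sum_range]
      refine Finset.sum_congr rfl fun j _ => ?_
      rw [pathLength_eq htx.le (hstart j)]
      simp
  · rintro ⟨τ, hτ, rfl⟩
    have hanti : ∀ j : Fin k, Antitone (τ j) := fun j =>
      antitone_nat_of_succ_le (hτ.anti j j.2)
    have hend : ∀ j : Fin k, τ j (m j + 1) = t := fun j =>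
      hτ.start j j.2 _ (by rw [vecNat_val]; exact Nat.lt_succ_self _)
    refine ⟨fun j => pathOf (τ j) (m j), ⟨fun j => isPath_pathOf htx.le _, ?_⟩, ?_⟩
    · rintro i j hij s ⟨hs, -⟩
      have hend' : ∀ j : Fin k, τ j (m j + 1) ≤ s := fun j => (hend j).le.trans hs.1.le
      have h1 := (pathOf_lt_iff (hanti j) (hend' j) (Nat.succ_pos _)).1
        (Nat.lt_succ_self (pathOf (τ j) (m j) s))
      have h2 := hτ.inter i (hij ▸ j.2) (pathOf (τ j) (m j) s)
      rw [hij] at h2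
      have h3 := h2.trans h1
      rcases Nat.eq_zero_or_pos (pathOf (τ j) (m j) s) with h0 | hpos
      · rw [h0, hτ.zero i i.2] at h3
        exact absurd hs.2 (not_lt.2 h3)
      · exact (pathOf_lt_iff (hanti i) (hend' i) hpos).2 h3
    · unfold weight
      rw [Finset.sum_range]
      refine Finset.sum_congr rfl fun j _ => ?_
      rw [pathLength_eq htx.le (pathOf_le _ _ _),
        jumpTime_pathOf (hanti j) (hτ.zero j j.2) (hτ.ge j j.2) (hend j)]

end Paths

/-! ### Last passage values from `-∞` -/

section FromBot

variable {n k : ℕ} {f g : Env n} {m m' : Fin k → Fin n} {a b : Fin n} {t x : ℝ}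
  {lam : Fin n → ℝ}

theorem vecNat_lt_succ (hm : StrictMono m) (j : ℕ) (hj : j + 1 < k) :
    vecNat m j < vecNat m (j + 1) := by
  have := hm (show (⟨j, by omega⟩ : Fin k) < ⟨j + 1, hj⟩ from Nat.lt_succ_self j)
  rw [vecNat, vecNat, dif_pos (by omega), dif_pos hj]
  exact this

theorem vecNat_lt (m : Fin k → Fin n) (j : ℕ) (hj : j < k) : vecNat m j < n := by
  rw [vecNat, dif_pos hj]
  exact (m _).2

theorem lppFrom_eq (htx : t < x) :
    lppFrom f m x t = sSup (weights n k (envNat f) (vecNat m) t x) +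
      ∑ j ∈ Finset.range k, envNat f (vecNat m j) t := by
  rw [lppFrom, lpp_eq htx, Finset.sum_range]
  simp only [vecNat_val, envNat_val]

theorem lppFrom_antitoneOn (hf : ∀ i, Continuous (f i)) (hm : StrictMono m) (x : ℝ) :
    AntitoneOn (lppFrom f m x) (Iio x) := by
  intro t' ht' t ht htt
  rw [lppFrom_eq ht, lppFrom_eq ht']
  rw [← le_sub_iff_add_le, add_sub_assoc, ← Finset.sum_sub_distrib]
  refine csSup_le (weights_nonempty (le_of_lt ht) (vecNat_lt_succ hm)) ?_
  rintro _ ⟨τ, hτ, rfl⟩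
  obtain ⟨τ', hτ', hw⟩ := IsArray.exists_earlier htt hτ (vecNat_lt_succ hm) (vecNat_lt m)
    (envNat f)
  have h := le_csSup (weights_bddAbove (n := n) (continuous_envNat hf)) ⟨τ', hτ', rfl⟩
  rw [hw, Finset.sum_sub_distrib] at h
  rw [Finset.sum_sub_distrib]
  linarith

/-- Monotonicity of G' squeezes it between its values at the agreement times, which are arbitrarily
far left. -/
theorem tendsto_of_antitoneOn_of_frequently_eq {G G' : ℝ → ℝ} {v : ℝ}
    (hG' : AntitoneOn G' (Iio x)) (heq : ∀ T, ∃ t ≤ T, G t = G' t)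
    (hG : Tendsto G atBot (𝓝 v)) : Tendsto G' atBot (𝓝 v) := by
  rw [tendsto_order] at hG ⊢
  constructor
  · intro c hc
    obtain ⟨T, hT⟩ := eventually_atBot.1 (hG.1 c hc)
    obtain ⟨t, ht, h⟩ := heq (min T (x - 1))
    filter_upwards [eventually_le_atBot t] with s hs
    have htx : t < x := by linarith [ht.trans (min_le_right _ _)]
    exact ((hT t (ht.trans (min_le_left _ _))).trans_eq h).trans_le
      (hG' (hs.trans_lt htx) htx hs)
  · intro c hc
    obtain ⟨T, hT⟩ := eventually_atBot.1 (hG.2 c hc)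
    filter_upwards [eventually_le_atBot T, eventually_lt_atBot x] with s hs hsx
    obtain ⟨t, ht, h⟩ := heq s
    exact (hG' (ht.trans_lt hsx) hsx ht).trans_lt (h ▸ hT t (ht.trans hs))

/-- The change of the starting vector under a nontrivial Pitman operator on lines `a` and `b`. -/
inductive StartStep (a b : Fin n) (m m' : Fin k → Fin n) : Prop
  | same (h : m' = m) (hab : a ∈ range m ↔ b ∈ range m)
  | move (j : Fin k) (hj : m j = b) (ha : a ∉ range m) (h : m' = Function.update m j a)

theorem isShift_pitman (hab : (a : ℕ) + 1 = b) (hlt : asympSlope f a < asympSlope f b)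
    {S : ℝ → ℝ} (H : IsRunMax (fun z => f b z - f a z) S) :
    IsShift a S (envNat f) (envNat (pitman a b f)) := by
  have hne : b ≠ a := fun h => lt_irrefl _ (h ▸ hlt)
  refine ⟨fun z => ?_, fun z => ?_, fun i hia hib => ?_⟩
  · rw [envNat_val, envNat_val, pitman_apply hlt H, if_pos rfl]
  · rw [hab, envNat_val, envNat_val, pitman_apply hlt H, if_neg hne, if_pos rfl]
  · funext z
    unfold envNat
    split_ifs with hi
    · rw [pitman_apply hlt H, if_neg (fun h => hia (by rw [← h])),
        if_neg (fun h => hib (by rw [hab, ← h]))]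
    · rfl

/-- The supremum is preserved by the shift. For the boundary sum, f_a + f_b is unchanged if both or
neither line is used; if only b is used, the transformed line a equals f_b at the record time t. -/
theorem lppFrom_pitman (hf : f ∈ C n) (hab : (a : ℕ) + 1 = b)
    (hlt : asympSlope f a < asympSlope f b) {S : ℝ → ℝ}
    (H : IsRunMax (fun z => f b z - f a z) S) (hm : StrictMono m) (hmm : StartStep a b m m')
    (htx : t < x) (hrec : f b t - f a t = S t) :
    lppFrom f m x t = lppFrom (pitman a b f) m' x t := by
  have hne : b ≠ a := fun h => lt_irrefl _ (h ▸ hlt)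
  have hF := isShift_pitman hab hlt H
  have hbn : (a : ℕ) + 1 < n := hab ▸ b.2
  have hEb : envNat f (a + 1) = f b := by rw [hab, envNat_val]
  have hEa : envNat f a = f a := envNat_val f a
  have H' : IsRunMax (fun z => envNat f (a + 1) z - envNat f a z) S := by rwa [hEb, hEa]
  have hc' : Continuous fun z => envNat f (a + 1) z - envNat f a z := by
    rw [hEb, hEa]
    exact (hf.1 b).sub (hf.1 a)
  have hcond : ∀ j < k, vecNat m j = a → j + 1 < k ∧ vecNat m (j + 1) = a + 1 := by
    intro j hj hja
    have hmj : m ⟨j, hj⟩ = a := Fin.ext (by rw [← hja, vecNat, dif_pos hj])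
    obtain ⟨j', hj'⟩ : b ∈ range m := by
      rcases hmm with ⟨_, h⟩ | ⟨_, _, h, _⟩
      · exact h.1 ⟨_, hmj⟩
      · exact absurd ⟨_, hmj⟩ h
    have hjj : j < j' := by
      have : m ⟨j, hj⟩ < m j' := by
        rw [hmj, hj', Fin.lt_def]
        omega
      exact hm.lt_iff_lt.1 this
    have hj1 : j + 1 < k := lt_of_le_of_lt hjj j'.2
    refine ⟨hj1, ?_⟩
    have h1 := vecNat_lt_succ hm j hj1
    have h2 : m ⟨j + 1, hj1⟩ ≤ m j' := hm.monotone hjj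
    rw [hj', Fin.le_def] at h2
    rw [hja] at h1
    rw [vecNat, dif_pos hj1] at h1 ⊢
    omega
  have hsup := hF.sSup_weights hbn htx.le hc' H' hcond
  rw [lppFrom_eq htx, lppFrom_eq htx, hsup]
  rcases hmm with ⟨rfl, hiff⟩ | ⟨j₀, hj₀, hama, rfl⟩
  · congr 1
    rw [Finset.sum_range, Finset.sum_range, ← sub_eq_zero, ← Finset.sum_sub_distrib]
    simp only [vecNat_val, envNat_val, pitman_apply hlt H]
    by_cases ha : a ∈ range m'
    · obtain ⟨i, hi⟩ := ha
      obtain ⟨j, hj⟩ := hiff.1 ⟨i, hi⟩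
      rw [Fintype.sum_eq_add i j (fun h => hne (by rw [← hi, ← hj, h]))]
      · rw [hi, hj, if_pos rfl, if_neg hne, if_pos rfl]
        ring
      · rintro l ⟨hli, hlj⟩
        rw [if_neg (fun h => hli (hm.injective (h.trans hi.symm))),
          if_neg (fun h => hlj (hm.injective (h.trans hj.symm))), sub_self]
    · refine Finset.sum_eq_zero fun l _ => ?_
      rw [if_neg (fun h => ha ⟨l, h⟩), if_neg (fun h => ha (hiff.2 ⟨l, h⟩)), sub_self]
  · have hupd : ∀ j : Fin k, Function.update m j₀ a j = if m j = b then a else m j := by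
      intro j
      rcases eq_or_ne j j₀ with rfl | h
      · rw [Function.update_self, if_pos hj₀]
      · rw [Function.update_of_ne h, if_neg fun h' => h (hm.injective (h'.trans hj₀.symm))]
    congr 1
    · refine hF.sSup_weights_start hbn H' (by rw [hEb, hEa]; exact hrec) (vecNat_lt_succ hm) ?_ ?_
      · intro j hj hja
        exact hama ⟨⟨j, hj⟩, Fin.ext (by rw [← hja, vecNat, dif_pos hj])⟩
      · intro j hj
        have hiff : (m ⟨j, hj⟩ : ℕ) = a + 1 ↔ m ⟨j, hj⟩ = b := by rw [hab, Fin.val_inj]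
        rw [vecNat, vecNat, dif_pos hj, dif_pos hj, hupd]
        simp only [hiff]
        split_ifs <;> rfl
    · rw [Finset.sum_range, Finset.sum_range]
      refine Finset.sum_congr rfl fun j _ => ?_
      simp only [vecNat_val, envNat_val, pitman_apply hlt H, hupd]
      by_cases h1 : m j = b
      · rw [if_pos h1, if_pos rfl, h1]
        linarith
      · rw [if_neg h1, if_neg h1, if_neg fun h2 => hama ⟨j, h2⟩]

theorem hasLppFromBot_pitman_iff (hf : f ∈ C n) (hab : (a : ℕ) + 1 = b)
    (hlt : asympSlope f a < asympSlope f b) (hm : StrictMono m) (hm' : StrictMono m')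
    (hmm : StartStep a b m m') (x v : ℝ) :
    HasLppFromBot f m x v ↔ HasLppFromBot (pitman a b f) m' x v := by
  obtain ⟨S, H⟩ := exists_isRunMax hf hlt
  have hrec : ∀ T, ∃ t ≤ T, lppFrom f m x t = lppFrom (pitman a b f) m' x t := by
    intro T
    obtain ⟨t, ht, hS⟩ := H.attained (min T (x - 1))
    refine ⟨t, ht.trans (min_le_left _ _), lppFrom_pitman hf hab hlt H hm hmm ?_ ?_⟩
    · linarith [ht.trans (min_le_right _ _)]
    · exact le_antisymm (H.le (le_refl t)) ((H.mono ht).trans_eq hS.symm)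
  have hC := (pitman_mem hf hlt).1
  constructor
  · exact tendsto_of_antitoneOn_of_frequently_eq (lppFrom_antitoneOn hC.1 hm' x) hrec
  · refine tendsto_of_antitoneOn_of_frequently_eq (lppFrom_antitoneOn hf.1 hm x) fun T => ?_
    obtain ⟨t, ht, h⟩ := hrec T
    exact ⟨t, ht, h.symm⟩

theorem hasLppFromBot_firstLines (g : Env n) (hk : k ≤ n) (x : ℝ) :
    HasLppFromBot g (Fin.castLE hk) x (∑ i : Fin k, g (Fin.castLE hk i) x) := by
  refine tendsto_const_nhds.congr' ?_
  filter_upwards [eventually_lt_atBot x] with t ht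
  have hw : weights n k (envNat g) (vecNat (Fin.castLE hk)) t x =
      weights n k (envNat g) (fun j => j) t x := by
    have hv : ∀ j < k, vecNat (Fin.castLE hk) j = j := fun j hj => by
      rw [vecNat, dif_pos hj, Fin.val_castLE]
    have harr : ∀ τ, IsArray k (vecNat (Fin.castLE hk)) t x τ ↔ IsArray k (fun j => j) t x τ := by
      refine fun τ => ⟨fun h => ⟨h.zero, h.anti, h.ge, fun j hj i hi => ?_, h.inter⟩,
        fun h => ⟨h.zero, h.anti, h.ge, fun j hj i hi => ?_, h.inter⟩⟩
      · exact h.start j hj i (by rwa [hv j hj])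
      · exact h.start j hj i (by rwa [hv j hj] at hi)
    simp only [weights, harr]
  rw [lppFrom_eq ht, hw, weights_firstLines hk ht.le, csSup_singleton, Finset.sum_range,
    Finset.sum_range, ← Finset.sum_add_distrib]
  refine Finset.sum_congr rfl fun j _ => ?_
  have h1 : envNat g j = g (Fin.castLE hk j) := envNat_val g (Fin.castLE hk j)
  rw [vecNat_val, envNat_val, h1]
  ring

/-! ### Lines of largest slope -/

/-- `m` enumerates the `k` lines with the largest slopes, where lines of equal slope are preferred
in increasing order. -/
structure IsTop (lam : Fin n → ℝ) (m : Fin k → Fin n) : Prop where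
  strictMono : StrictMono m
  le : ∀ p ∈ range m, ∀ q ∉ range m, lam q ≤ lam p
  lt : ∀ p ∈ range m, ∀ q ∉ range m, lam q = lam p → p < q

theorem range_update_iff (hm : Function.Injective m) {j : Fin k} (hj : m j = b)
    (ha : a ∉ range m) (p : Fin n) :
    p ∈ range (Function.update m j a) ↔ Equiv.swap a b p ∈ range m := by
  have hother : ∀ i ≠ j, m i ≠ a ∧ m i ≠ b := fun i hi =>
    ⟨fun h => ha ⟨i, h⟩, fun h => hi (hm (h.trans hj.symm))⟩
  constructor
  · rintro ⟨i, rfl⟩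
    rcases eq_or_ne i j with rfl | hi
    · rw [Function.update_self, Equiv.swap_apply_left]
      exact ⟨i, hj⟩
    · rw [Function.update_of_ne hi, Equiv.swap_apply_of_ne_of_ne (hother i hi).1 (hother i hi).2]
      exact ⟨i, rfl⟩
  · rintro ⟨i, hi⟩
    have hp : p = Equiv.swap a b (m i) := by rw [hi, Equiv.swap_apply_self]
    rcases eq_or_ne i j with rfl | hij
    · rw [hj, Equiv.swap_apply_right] at hp
      exact ⟨i, by rw [Function.update_self, hp]⟩
    · rw [Equiv.swap_apply_of_ne_of_ne (hother i hij).1 (hother i hij).2] at hp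
      exact ⟨i, by rw [Function.update_of_ne hij, hp]⟩

theorem mem_range_iff_swap (hab : a ∈ range m ↔ b ∈ range m) (p : Fin n) :
    p ∈ range m ↔ Equiv.swap a b p ∈ range m := by
  rcases eq_or_ne p a with rfl | ha
  · rw [Equiv.swap_apply_left, hab]
  · rcases eq_or_ne p b with rfl | hb
    · rw [Equiv.swap_apply_right, hab]
    · rw [Equiv.swap_apply_of_ne_of_ne ha hb]

/-- The chosen lines move with their slopes. A swap of adjacent indices can only reverse the order
of the pair a, b itself, which is not a tie. -/
theorem IsTop.swap (hm : IsTop lam m) (hab : (a : ℕ) + 1 = b) (hne : lam a ≠ lam b)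
    (hm' : StrictMono m') (hr : ∀ p, p ∈ range m' ↔ Equiv.swap a b p ∈ range m) :
    IsTop (lam ∘ Equiv.swap a b) m' := by
  refine ⟨hm', fun p hp q hq => ?_, fun p hp q hq heq => ?_⟩
  · rw [hr] at hp hq
    exact hm.le _ hp _ hq
  · rw [hr] at hp hq
    have hlt := hm.lt _ hp _ hq heq
    simp only [Function.comp_apply] at heq
    rw [Fin.lt_def] at hlt ⊢
    rw [Equiv.swap_apply_def, Equiv.swap_apply_def] at heq hlt
    split_ifs at heq hlt with h1 h2 h2 h3 h4 h5 h6 h7 <;>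
      first
      | exact absurd heq hne
      | exact absurd heq.symm hne
      | (simp only [Fin.ext_iff] at *; omega)

theorem strictMono_update_left (hab : (a : ℕ) + 1 = b) (hm : StrictMono m) {j : Fin k}
    (hj : m j = b) (ha : a ∉ range m) : StrictMono (Function.update m j a) := by
  intro p q hpq
  have h := hm hpq
  rcases eq_or_ne p j with rfl | hp
  · rw [Function.update_self, Function.update_of_ne hpq.ne', Fin.lt_def]
    rw [hj, Fin.lt_def] at h
    omega
  · rw [Function.update_of_ne hp]
    rcases eq_or_ne q j with rfl | hq
    · rw [Function.update_self, Fin.lt_def]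
      rw [hj, Fin.lt_def] at h
      have : (m p : ℕ) ≠ a := fun h' => ha ⟨p, Fin.ext h'⟩
      omega
    · rwa [Function.update_of_ne hq]

theorem strictMono_update_right (hab : (a : ℕ) + 1 = b) (hm : StrictMono m) {j : Fin k}
    (hj : m j = a) (hb : b ∉ range m) : StrictMono (Function.update m j b) := by
  intro p q hpq
  have h := hm hpq
  rcases eq_or_ne p j with rfl | hp
  · rw [Function.update_self, Function.update_of_ne hpq.ne', Fin.lt_def]
    rw [hj, Fin.lt_def] at h
    have : (m q : ℕ) ≠ b := fun h' => hb ⟨q, Fin.ext h'⟩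
    omega
  · rw [Function.update_of_ne hp]
    rcases eq_or_ne q j with rfl | hq
    · rw [Function.update_self, Fin.lt_def]
      rw [hj, Fin.lt_def] at h
      omega
    · rwa [Function.update_of_ne hq]

theorem IsTop.exists_startStep (hm : IsTop lam m) (hab : (a : ℕ) + 1 = b) (hlt : lam a < lam b) :
    ∃ m' : Fin k → Fin n, IsTop (lam ∘ Equiv.swap a b) m' ∧ StartStep a b m m' := by
  by_cases hiff : a ∈ range m ↔ b ∈ range m
  · exact ⟨m, hm.swap hab hlt.ne hm.strictMono (mem_range_iff_swap hiff), .same rfl hiff⟩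
  · have himp : a ∈ range m → b ∈ range m := fun ha => by
      by_contra hb
      exact absurd (hm.le a ha b hb) (not_le.2 hlt)
    have hb : b ∈ range m := by tauto
    have ha : a ∉ range m := by tauto
    obtain ⟨j, hj⟩ := hb
    exact ⟨_, hm.swap hab hlt.ne (strictMono_update_left hab hm.strictMono hj ha)
      (range_update_iff hm.strictMono.injective hj ha), .move j hj ha rfl⟩

theorem IsTop.exists_startStep_symm (hm : IsTop (lam ∘ Equiv.swap a b) m')
    (hab : (a : ℕ) + 1 = b) (hlt : lam a < lam b) :
    ∃ m : Fin k → Fin n, IsTop lam m ∧ StartStep a b m m' := by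
  have hne : (lam ∘ Equiv.swap a b) a ≠ (lam ∘ Equiv.swap a b) b := by
    simpa using hlt.ne'
  have hswap : (lam ∘ Equiv.swap a b) ∘ Equiv.swap a b = lam := by
    funext i
    simp
  have hab' : a ≠ b := fun h => lt_irrefl _ (h ▸ hlt)
  by_cases hiff : a ∈ range m' ↔ b ∈ range m'
  · have := hm.swap hab hne hm.strictMono (mem_range_iff_swap hiff)
    rw [hswap] at this
    exact ⟨m', this, .same rfl hiff⟩
  · have himp : b ∈ range m' → a ∈ range m' := fun hb => by
      by_contra ha
      have := hm.le b hb a ha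
      simp only [Function.comp_apply, Equiv.swap_apply_left, Equiv.swap_apply_right] at this
      exact absurd this (not_le.2 hlt)
    have ha : a ∈ range m' := by tauto
    have hb : b ∉ range m' := by tauto
    obtain ⟨j, hj⟩ := ha
    have hr := range_update_iff hm.strictMono.injective hj hb
    have := hm.swap hab hne (strictMono_update_right hab hm.strictMono hj hb)
      (fun p => by rw [hr, Equiv.swap_comm])
    rw [hswap] at this
    refine ⟨_, this, .move j (Function.update_self _ _ _) ?_ ?_⟩
    · rw [hr, Equiv.swap_apply_right]
      exact hb
    · rw [Function.update_idem, ← hj, Function.update_eq_self]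

theorem isTop_firstLines (hlam : Antitone lam) (hk : k ≤ n) : IsTop lam (Fin.castLE hk) := by
  have key : ∀ p ∈ range (Fin.castLE hk), ∀ q ∉ range (Fin.castLE hk), p < q := by
    rintro _ ⟨j, rfl⟩ q hq
    by_contra! h
    exact hq ⟨⟨q, lt_of_le_of_lt (Fin.le_def.1 h) j.2⟩, rfl⟩
  exact ⟨Fin.strictMono_castLE hk, fun p hp q hq => hlam (key p hp q hq).le,
    fun p hp q hq _ => key p hp q hq⟩

theorem mem_range_of_admissible (hlam : Monotone lam) (hm : m ∈ admissible lam k) {p q : Fin n}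
    (hp : p ∈ range m) (hqp : q ≤ p) (hl : lam q = lam p) : q ∈ range m := by
  obtain ⟨d, hd⟩ : ∃ d, (p : ℕ) = q + d := ⟨p - q, by rw [Fin.le_def] at hqp; omega⟩
  induction d generalizing p with
  | zero => exact (Fin.ext hd : p = q) ▸ hp
  | succ d ih =>
    have hlt : (q : ℕ) + d < n := by omega
    have h1 : lam q ≤ lam ⟨q + d, hlt⟩ := hlam (Fin.le_def.2 (Nat.le_add_right _ _))
    have h2 : lam ⟨q + d, hlt⟩ ≤ lam p := hlam (Fin.le_def.2 (by rw [hd]; simp))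
    have hmem : (⟨q + d, hlt⟩ : Fin n) ∈ range m := by
      by_contra hcon
      exact absurd (hm.2 p ⟨q + d, hlt⟩ (by rw [hd]; rfl) hp hcon) (by linarith)
    exact ih hmem (Fin.le_def.2 (Nat.le_add_right _ _)) (by linarith) rfl

theorem IsTop.isGreatest (hm : IsTop lam m) (hlam : Monotone lam) :
    IsGreatest (admissible lam k) m := by
  refine ⟨⟨hm.strictMono, fun p q hpq hp hq => ?_⟩, fun m' hm' j => ?_⟩
  · refine (hm.le p hp q hq).lt_of_ne fun h => ?_
    have := Fin.lt_def.1 (hm.lt p hp q hq h)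
    omega
  · by_contra! hj
    -- Otherwise the k - j values of m' from position j on would all be among the k - j - 1 values
    -- of m after position j.
    obtain ⟨l, hjl, hl⟩ : ∃ l, j ≤ l ∧ m' l ∉ range m := by
      by_contra! hcon
      have hsub : (Finset.Ici j).image m' ⊆ (Finset.Ioi j).image m := by
        intro p hp
        obtain ⟨l, hl, rfl⟩ := Finset.mem_image.1 hp
        rw [Finset.mem_Ici] at hl
        obtain ⟨i, hi⟩ := hcon l hl
        refine Finset.mem_image.2 ⟨i, Finset.mem_Ioi.2 ?_, hi⟩
        rw [← hm.strictMono.lt_iff_lt, hi]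
        exact hj.trans_le (hm'.1.monotone hl)
      have := Finset.card_le_card hsub
      rw [Finset.card_image_of_injective _ hm'.1.injective,
        Finset.card_image_of_injective _ hm.strictMono.injective, Fin.card_Ici, Fin.card_Ioi]
        at this
      omega
    have hjp : m j < m' l := hj.trans_le (hm'.1.monotone hjl)
    have hc : lam (m j) = lam (m' l) :=
      le_antisymm (hlam hjp.le) (hm.le _ ⟨j, rfl⟩ _ hl)
    -- All m i with i ≤ j share the slope of m' l, so admissibility, followed down this block, puts
    -- them in the range of m'. They lie below m' j, leaving j + 1 values for j positions.
    have hsub : (Finset.Iic j).image m ⊆ (Finset.Iio j).image m' := by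
      intro p hp
      obtain ⟨i, hi, rfl⟩ := Finset.mem_image.1 hp
      have hij := hm.strictMono.monotone (Finset.mem_Iic.1 hi)
      have hil : lam (m i) = lam (m' l) :=
        le_antisymm ((hlam hij).trans_eq hc) (hm.le _ ⟨i, rfl⟩ _ hl)
      obtain ⟨r, hr⟩ := mem_range_of_admissible hlam hm' ⟨l, rfl⟩ (hij.trans hjp.le) hil
      refine Finset.mem_image.2 ⟨r, Finset.mem_Iio.2 ?_, hr⟩
      rw [← hm'.1.lt_iff_lt, hr]
      exact hij.trans_lt hj
    have := Finset.card_le_card hsub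
    rw [Finset.card_image_of_injective _ hm'.1.injective,
      Finset.card_image_of_injective _ hm.strictMono.injective, Fin.card_Iic, Fin.card_Iio] at this
    omega

theorem isGreatest_lastLines (hlam : StrictMono lam) (hk : k ≤ n) :
    IsGreatest (admissible lam k) (lastLines n k hk) := by
  refine ⟨⟨fun i j hij => ?_, fun p q hpq _ _ => hlam (Fin.lt_def.2 (by omega))⟩,
    fun m hm j => ?_⟩
  · exact Fin.lt_def.2 (Nat.add_lt_add_left hij _)
  · have hsub : (Finset.Ici j).image m ⊆ Finset.Ici (m j) := by
      intro p hp
      obtain ⟨i, hi, rfl⟩ := Finset.mem_image.1 hp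
      exact Finset.mem_Ici.2 (hm.1.monotone (Finset.mem_Ici.1 hi))
    have := Finset.card_le_card hsub
    rw [Finset.card_image_of_injective _ hm.1.injective, Fin.card_Ici, Fin.card_Ici] at this
    rw [Fin.le_def, lastLines]
    simp only
    omega

/-! ### Greene's theorem for orbits -/

/-- The last passage values from the `k` lines of largest slope are `v`. -/
def TopLpp (f : Env n) (k : ℕ) (v : ℝ → ℝ) : Prop :=
  ∃ m : Fin k → Fin n, IsTop (asympSlope f) m ∧ ∀ x, HasLppFromBot f m x (v x)

theorem topLpp_pitman_iff (hf : f ∈ C n) (hab : (a : ℕ) + 1 = b)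
    (hlt : asympSlope f a < asympSlope f b) (k : ℕ) (v : ℝ → ℝ) :
    TopLpp f k v ↔ TopLpp (pitman a b f) k v := by
  unfold TopLpp
  rw [(pitman_mem hf hlt).2]
  constructor
  · rintro ⟨m, hm, h⟩
    obtain ⟨m', hm', hs⟩ := hm.exists_startStep hab hlt
    exact ⟨m', hm', fun x =>
      (hasLppFromBot_pitman_iff hf hab hlt hm.strictMono hm'.strictMono hs x _).1 (h x)⟩
  · rintro ⟨m', hm', h⟩
    obtain ⟨m, hm, hs⟩ := hm'.exists_startStep_symm hab hlt
    exact ⟨m, hm, fun x =>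
      (hasLppFromBot_pitman_iff hf hab hlt hm.strictMono hm'.strictMono hs x _).2 (h x)⟩

/-- For g the top lines are the first k, where the value is explicit. Transport back along the orbit
also produces the top vector for f. -/
theorem topLpp_of_mem_orbit (hf : f ∈ C n) (hg : g ∈ orbit f) (hg' : g ∈ CGE n) (hk : k ≤ n) :
    TopLpp f k (fun x => ∑ i : Fin k, g (Fin.castLE hk i) x) := by
  refine ((orbit_induction_of_iff
    (p := fun f => TopLpp f k (fun x => ∑ i : Fin k, g (Fin.castLE hk i) x)) hf ?_ hg).2).2 ?_
  · exact fun g hg a b hab hlt => topLpp_pitman_iff hg hab hlt k _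
  · exact ⟨_, isTop_firstLines hg'.2 hk, hasLppFromBot_firstLines g hk⟩

theorem exists_isGreatest_of_mem_orbit (hf : f ∈ CLE n) (hg : g ∈ orbit f) (hg' : g ∈ CGE n)
    (hk : k ≤ n) : ∃ nk : Fin k → Fin n, IsGreatest (admissible (asympSlope f) k) nk ∧
      ∀ x, HasLppFromBot f nk x (∑ i : Fin k, g (Fin.castLE hk i) x) := by
  obtain ⟨m, hm, h⟩ := topLpp_of_mem_orbit hf.1 hg hg' hk
  exact ⟨m, hm.isGreatest hf.2, h⟩

theorem sum_castLE_succ (g : Env n) (i : Fin n) (x : ℝ) :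
    ∑ j : Fin ((i : ℕ) + 1), g (Fin.castLE i.isLt j) x -
      ∑ j : Fin (i : ℕ), g (Fin.castLE i.isLt.le j) x = g i x := by
  rw [Fin.sum_univ_castSucc]
  exact add_sub_cancel_left _ _

/-- The partial sums of both candidates are the same last passage values of f, because the greatest
admissible vector is unique. -/
theorem eq_of_mem_orbit_CGE {g' : Env n} (hf : f ∈ CLE n) (hg : g ∈ orbit f ∧ g ∈ CGE n)
    (hg' : g' ∈ orbit f ∧ g' ∈ CGE n) : g = g' := by
  have hsum : ∀ (k : ℕ) (hk : k ≤ n) (x : ℝ),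
      ∑ i : Fin k, g (Fin.castLE hk i) x = ∑ i : Fin k, g' (Fin.castLE hk i) x := by
    intro k hk x
    obtain ⟨m, hm, h⟩ := exists_isGreatest_of_mem_orbit hf hg.1 hg.2 hk
    obtain ⟨m', hm', h'⟩ := exists_isGreatest_of_mem_orbit hf hg'.1 hg'.2 hk
    rw [hm'.unique hm] at h'
    exact tendsto_nhds_unique (h x) (h' x)
  funext i x
  rw [← sum_castLE_succ g, ← sum_castLE_succ g', hsum, hsum]

/-! ### The RSK maps and their inverses -/

theorem existsUnique_CGE (hf : f ∈ CLE n) : ∃! g, g ∈ orbit f ∧ g ∈ CGE n := by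
  obtain ⟨g, hg, hg'⟩ := exists_mem_orbit_CGE hf.1
  exact ⟨g, ⟨hg, hg'⟩, fun e he => eq_of_mem_orbit_CGE hf he ⟨hg, hg'⟩⟩

theorem existsUnique_CLE (hg : g ∈ CGE n) : ∃! f, f ∈ orbit g ∧ f ∈ CLE n := by
  have hRR : ∀ {e}, e ∈ orbit (R g) → R e ∈ orbit g := fun {e} he => by
    have := R_mem_orbit he
    rwa [R_R] at this
  obtain ⟨e, ⟨he, he'⟩, huniq⟩ := existsUnique_CGE (R_mem_CLE hg)
  refine ⟨R e, ⟨hRR he, R_mem_CLE he'⟩, fun f hf => ?_⟩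
  rw [← huniq (R f) ⟨R_mem_orbit hf.1, R_mem_CGE hf.2⟩, R_R]

theorem PRSK_mem (hf : f ∈ CLE n) : PRSK f ∈ orbit f ∧ PRSK f ∈ CGE n :=
  Classical.epsilon_spec (existsUnique_CGE hf).exists

theorem QRSK_mem (hg : g ∈ CGE n) : QRSK g ∈ orbit g ∧ QRSK g ∈ CLE n :=
  Classical.epsilon_spec (existsUnique_CLE hg).exists

theorem QRSK_PRSK (hf : f ∈ CLE n) : QRSK (PRSK f) = f := by
  obtain ⟨h1, h2⟩ := PRSK_mem hf
  exact (existsUnique_CLE h2).unique (QRSK_mem h2) ⟨orbit_symm hf.1 h1, hf⟩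

theorem PRSK_QRSK (hg : g ∈ CGE n) : PRSK (QRSK g) = g := by
  obtain ⟨h1, h2⟩ := QRSK_mem hg
  exact (existsUnique_CGE h2).unique (PRSK_mem h2) ⟨orbit_symm hg.1 h1, hg⟩

theorem QRSK_eq (hg : g ∈ CGE n) : QRSK g = R (PRSK (R g)) := by
  obtain ⟨h1, h2⟩ := PRSK_mem (R_mem_CLE hg)
  refine (existsUnique_CLE hg).unique (QRSK_mem hg) ⟨?_, R_mem_CLE h2⟩
  have := R_mem_orbit h1
  rwa [R_R] at this

theorem PRSK_R_PRSK (hf : f ∈ CLE n) : PRSK (R (PRSK f)) = R f := by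
  have h := QRSK_eq (PRSK_mem hf).2
  rw [QRSK_PRSK hf] at h
  rw [congrArg R h, R_R]

theorem invOn_QRSK_PRSK (n : ℕ) : InvOn QRSK PRSK (CLE n) (CGE n) :=
  ⟨fun _ => QRSK_PRSK, fun _ => PRSK_QRSK⟩

/-- Slopes are permuted along orbits, and a monotone rearrangement of a vector is unique. -/
theorem asympSlope_PRSK (hf : f ∈ CLE n) :
    asympSlope (PRSK f) = fun i => asympSlope f (Fin.rev i) := by
  obtain ⟨h1, h2⟩ := PRSK_mem hf
  obtain ⟨σ, hσ⟩ := exists_perm_of_mem_orbit hf.1 h1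
  have hmono : Monotone (asympSlope f ∘ (σ * Fin.revPerm : Equiv.Perm (Fin n))) := by
    intro i j hij
    have := h2.2 (Fin.rev_le_rev.2 hij)
    rw [hσ] at this
    exact this
  have heq := Tuple.unique_monotone (σ := σ * Fin.revPerm) (τ := 1) hmono hf.2
  rw [hσ]
  funext i
  have := congrFun heq (Fin.rev i)
  simpa using this

/-! ### Strictly ordered slopes and the map `W` -/

theorem CLT_subset (n : ℕ) : CLT n ⊆ CLE n := fun _ h => ⟨h.1, h.2.monotone⟩

theorem CGT_subset (n : ℕ) : CGT n ⊆ CGE n := fun _ h => ⟨h.1, h.2.antitone⟩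

theorem PRSK_mem_CGT (hf : f ∈ CLT n) : PRSK f ∈ CGT n := by
  have hf' := CLT_subset n hf
  refine ⟨(PRSK_mem hf').2.1, ?_⟩
  rw [asympSlope_PRSK hf']
  exact fun i j hij => hf.2 (Fin.rev_lt_rev.2 hij)

theorem hasLppFromBot_lastLines (hf : f ∈ CLT n) (hk : k ≤ n) (x : ℝ) :
    HasLppFromBot f (lastLines n k hk) x (∑ i : Fin k, PRSK f (Fin.castLE hk i) x) := by
  have hf' := CLT_subset n hf
  obtain ⟨m, hm, h⟩ :=
    exists_isGreatest_of_mem_orbit hf' (PRSK_mem hf').1 (PRSK_mem hf').2 hk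
  rw [(isGreatest_lastLines hf.2 hk).unique hm]
  exact h x

theorem W_eq_PRSK (hf : f ∈ CLT n) : W f = PRSK f := by
  funext i x
  rw [W, (hasLppFromBot_lastLines hf i.isLt x).limUnder_eq,
    (hasLppFromBot_lastLines hf i.isLt.le x).limUnder_eq, sum_castLE_succ]

theorem R_W_R_eq (hg : g ∈ CGT n) : R (W (R g)) = QRSK g := by
  rw [W_eq_PRSK (R_mem_CLT hg), QRSK_eq (CGT_subset n hg)]

theorem QRSK_mem_CLT (hg : g ∈ CGT n) : QRSK g ∈ CLT n := by
  rw [QRSK_eq (CGT_subset n hg)]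
  exact R_mem_CLT (PRSK_mem_CGT (R_mem_CLT hg))

theorem invOn_R_W_R (n : ℕ) : InvOn (fun g => R (W (R g))) W (CLT n) (CGT n) := by
  constructor
  · intro f hf
    simp only
    rw [W_eq_PRSK hf, R_W_R_eq (PRSK_mem_CGT hf), QRSK_PRSK (CLT_subset n hf)]
  · intro g hg
    simp only
    rw [R_W_R_eq hg, W_eq_PRSK (QRSK_mem_CLT hg), PRSK_QRSK (CGT_subset n hg)]

theorem mapsTo_W (n : ℕ) : MapsTo W (CLT n) (CGT n) := fun f hf => by
  rw [W_eq_PRSK hf]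
  exact PRSK_mem_CGT hf

theorem mapsTo_R_W_R (n : ℕ) : MapsTo (fun g => R (W (R g))) (CGT n) (CLT n) := fun g hg => by
  simp only
  rw [R_W_R_eq hg]
  exact QRSK_mem_CLT hg

end FromBot

end RSKLine

open RSKLine in
theorem corollaryC (n : ℕ) :
    -- `PRSK` and `QRSK` are well defined
    (∀ f ∈ CLE n, (∃! g, g ∈ orbit f ∧ g ∈ CGE n) ∧ PRSK f ∈ orbit f ∧ PRSK f ∈ CGE n) ∧
    (∀ g ∈ CGE n, (∃! f, f ∈ orbit g ∧ f ∈ CLE n) ∧ QRSK g ∈ orbit g ∧ QRSK g ∈ CLE n) ∧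
    -- they are mutually inverse bijections
    Set.BijOn PRSK (CLE n) (CGE n) ∧
    Set.BijOn QRSK (CGE n) (CLE n) ∧
    Set.InvOn QRSK PRSK (CLE n) (CGE n) ∧
    -- `QRSK = R PRSK R`, and `PRSK R` is an involution of `CGE n`
    (∀ g ∈ CGE n, QRSK g = R (PRSK (R g))) ∧
    Set.MapsTo (fun g => PRSK (R g)) (CGE n) (CGE n) ∧
    (∀ g ∈ CGE n, PRSK (R (PRSK (R g))) = g) ∧
    -- last passage formulas for `g = PRSK f` in terms of `f` and for `f` in terms of `R g`
    (∀ f ∈ CLE n, ∀ (k : ℕ) (hk : k ≤ n),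
      (∃ nk : Fin k → Fin n, IsGreatest (admissible (asympSlope f) k) nk ∧
        ∀ x : ℝ, HasLppFromBot f nk x (∑ i : Fin k, PRSK f (Fin.castLE hk i) x)) ∧
      (∃ mk : Fin k → Fin n,
        IsGreatest (admissible (fun i => -asympSlope f (Fin.rev i)) k) mk ∧
        ∀ x : ℝ, HasLppFromBot (R (PRSK f)) mk (-x) (∑ i : Fin k, f (Fin.castLE hk i) x))) ∧
    -- for strictly increasing slopes: the formula defining `W` makes sense, `W = PRSK`, and
    -- `W` is a bijection with inverse `R W R`
    (∀ f ∈ CLT n, ∀ (k : ℕ) (hk : k ≤ n) (x : ℝ),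
      HasLppFromBot f (lastLines n k hk) x (∑ i : Fin k, W f (Fin.castLE hk i) x)) ∧
    (∀ f ∈ CLT n, W f = PRSK f) ∧
    Set.BijOn W (CLT n) (CGT n) ∧
    Set.BijOn (fun g => R (W (R g))) (CGT n) (CLT n) ∧
    Set.InvOn (fun g => R (W (R g))) W (CLT n) (CGT n) := by
  have hP : MapsTo PRSK (CLE n) (CGE n) := fun f hf => (PRSK_mem hf).2
  have hQ : MapsTo QRSK (CGE n) (CLE n) := fun g hg => (QRSK_mem hg).2
  refine ⟨fun f hf => ⟨existsUnique_CGE hf, PRSK_mem hf⟩,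
    fun g hg => ⟨existsUnique_CLE hg, QRSK_mem hg⟩, (invOn_QRSK_PRSK n).bijOn hP hQ,
    (invOn_QRSK_PRSK n).symm.bijOn hQ hP, invOn_QRSK_PRSK n, fun g hg => QRSK_eq hg,
    fun g hg => (PRSK_mem (R_mem_CLE hg)).2, fun g hg => ?_, fun f hf k hk => ⟨?_, ?_⟩,
    fun f hf k hk x => ?_, fun f hf => W_eq_PRSK hf,
    (invOn_R_W_R n).bijOn (mapsTo_W n) (mapsTo_R_W_R n),
    (invOn_R_W_R n).symm.bijOn (mapsTo_R_W_R n) (mapsTo_W n), invOn_R_W_R n⟩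
  · rw [PRSK_R_PRSK (R_mem_CLE hg), R_R]
  · exact exists_isGreatest_of_mem_orbit hf (PRSK_mem hf).1 (PRSK_mem hf).2 hk
  · have hg := (PRSK_mem hf).2
    have hRg := R_mem_CLE hg
    obtain ⟨m, hm, h⟩ :=
      exists_isGreatest_of_mem_orbit hRg (PRSK_mem hRg).1 (PRSK_mem hRg).2 hk
    -- Reflection negates the slopes of `PRSK f`, which are those of f reversed; this is the vector
    -- in the second admissibility condition.
    rw [asympSlope_R hg.1, asympSlope_PRSK hf] at hm
    refine ⟨m, hm, fun x => ?_⟩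
    have := h (-x)
    rw [PRSK_R_PRSK hf] at this
    simpa [R] using this
  · rw [W_eq_PRSK hf]
    exact hasLppFromBot_lastLines hf hk x
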